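/- Let $n\in\mathbb N$, let $g:\mathbb R^n\to\mathbb R$ be of class $C^2$, and let $$u(x,t)=\min_{|y-x|\le t} g(y),\qquad x\in\mathbb R^n,\ t>0,$$ be the Hopf–Lax solution of the time-dependent Eikonal equation $u_t+|\nabla u|=0$, $u(\cdot,0)=g$ ($|\cdot|$ is the Euclidean norm). A point $y$ with $|y-x|\le t$ and $g(y)=u(x,t)$ is called a minimizer for $(x,t)$. For $y$ with $Dg(y)\ne0$ put $X(y,t)=y+t\,\frac{Dg(y)}{|Dg(y)|}$ and define in $[0,\infty]$ $$\bar t_s(y)=\sup\{t>0 : y\text{ is the unique minimizer for }(X(y,t),t)\},$$ $$t_s(y)=\inf\{t>0 : y\text{ is not a minimizer for }(X(y,t),t)\},\qquad \inf\emptyset=\infty .$$ Let $M=\{y : Dg(y)\neq0,\ \bar t_s(y)<\infty\}$, and for $S\subset M$ let $$T(S)=\{(X(y,t),t) : y\in S,\ 0<t<\infty,\ \bar t_s(y)\le t\le t_s(y)\}.$$ Let $\Sigma\subset\mathbb R^n\times(0,\infty)$ be the set of points at which $u$ is not differentiable as a function of $(x,t)$, and let $T_1$ be the set of points of $T(M)$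 that have a unique minimizer. Let $$E=\{y : Dg(y)\ne0,\ \exists\, z\text{ with }(z-y)\cdot Dg(y)>0\text{ and }g(z)<g(y)\},$$ let $(E_i)_i$ be the family of the path components of $E$, and let $F_i$ be the union of $E_i$ and the set of all $y\in M\setminus E$ that have a neighbourhood $U$ with $\{z\in U : g(z)>g(y)\}\subset E_i$. Then: 1. the family $(E_i)_i$, and hence $(F_i)_i$, is at most countable, and $\Sigma\cup T_1=\bigcup_i T(F_i)$; 2. each $T(F_i)$ is path connected; 3. $\Sigma\cup T_1$ has at most countably many path components $S_j$, and $\Sigma\cup T_1=\bigcup_j S_j$. -/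

import Mathlib

open scoped Gradient Topology ENNReal

namespace Eikonal

noncomputable section

/-- The Hopf-Lax solution `u(x, t) = min_{|y - x| ≤ t} g(y)` of `u_t + |∇u| = 0`, `u(·, 0) = g`.
For `t ≥ 0` and continuous `g` the infimum is a minimum, see `hopfLax_isLeast`. -/
def hopfLax {n : ℕ} (g : EuclideanSpace ℝ (Fin n) → ℝ) (x : EuclideanSpace ℝ (Fin n)) (t : ℝ) :
    ℝ :=
  sInf (g '' Metric.closedBall x t)

theorem hopfLax_isLeast {n : ℕ} {g : EuclideanSpace ℝ (Fin n) → ℝ} (hg : Continuous g)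
    (x : EuclideanSpace ℝ (Fin n)) {t : ℝ} (ht : 0 ≤ t) :
    IsLeast (g '' Metric.closedBall x t) (hopfLax g x t) :=
  ((isCompact_closedBall x t).image hg).isLeast_sInf
    ((Metric.nonempty_closedBall.2 ht).image g)

/-- `L(x, t)`: the set of minimizers for `(x, t)`. -/
def minimizers {n : ℕ} (g : EuclideanSpace ℝ (Fin n) → ℝ) (x : EuclideanSpace ℝ (Fin n)) (t : ℝ) :
    Set (EuclideanSpace ℝ (Fin n)) :=
  {y | y ∈ Metric.closedBall x t ∧ hopfLax g x t = g y}

/-- The set `Σ` of points of the open upper half space at which the solution, as a function of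
`(x, t)`, is not differentiable. -/
def nondiffSet {n : ℕ} (g : EuclideanSpace ℝ (Fin n) → ℝ) : Set (EuclideanSpace ℝ (Fin n) × ℝ) :=
  {p | 0 < p.2 ∧
    ¬ DifferentiableAt ℝ (fun q : EuclideanSpace ℝ (Fin n) × ℝ => hopfLax g q.1 q.2) p}

/-- The point `y + t Dg(y) / |Dg(y)|` of the characteristic from `y` at time `t`
(used only where `Dg(y) ≠ 0`). -/
def charPoint {n : ℕ} (g : EuclideanSpace ℝ (Fin n) → ℝ) (y : EuclideanSpace ℝ (Fin n)) (t : ℝ) :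
    EuclideanSpace ℝ (Fin n) :=
  y + t • (‖∇ g y‖⁻¹ • ∇ g y)

/-- The first termination time: the supremum of the times `t > 0` at which `y` is the unique
minimizer for the point of its characteristic at time `t`. -/
def firstTime {n : ℕ} (g : EuclideanSpace ℝ (Fin n) → ℝ) (y : EuclideanSpace ℝ (Fin n)) : ℝ≥0∞ :=
  sSup (ENNReal.ofReal '' {t : ℝ | 0 < t ∧ minimizers g (charPoint g y t) t = {y}})

/-- The second termination time: the infimum of the times `t > 0` at which `y` is not a
minimizer for the point of its characteristic at time `t` (`∞` if there is no such time). -/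
def secondTime {n : ℕ} (g : EuclideanSpace ℝ (Fin n) → ℝ) (y : EuclideanSpace ℝ (Fin n)) : ℝ≥0∞ :=
  sInf (ENNReal.ofReal '' {t : ℝ | 0 < t ∧ y ∉ minimizers g (charPoint g y t) t})

/-- `M`: the points with `Dg ≠ 0` whose first termination time is finite. -/
def terminatingSet {n : ℕ} (g : EuclideanSpace ℝ (Fin n) → ℝ) : Set (EuclideanSpace ℝ (Fin n)) :=
  {y | ∇ g y ≠ 0 ∧ firstTime g y < ⊤}

/-- `T(S)`: the points on the characteristics from points `y ∈ S` at finite positive times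
between the first and the second termination time of `y`, both included. -/
def terminationPoints {n : ℕ} (g : EuclideanSpace ℝ (Fin n) → ℝ)
    (S : Set (EuclideanSpace ℝ (Fin n))) : Set (EuclideanSpace ℝ (Fin n) × ℝ) :=
  {p | 0 < p.2 ∧ ∃ y ∈ S, p.1 = charPoint g y p.2 ∧
    firstTime g y ≤ ENNReal.ofReal p.2 ∧ ENNReal.ofReal p.2 ≤ secondTime g y}

/-- `T₁`: the points of `T(M)` that have a unique minimizer. -/
def uniqueTerminationSet {n : ℕ} (g : EuclideanSpace ℝ (Fin n) → ℝ) :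
    Set (EuclideanSpace ℝ (Fin n) × ℝ) :=
  {p | p ∈ terminationPoints g (terminatingSet g) ∧ ∃! y, y ∈ minimizers g p.1 p.2}

/-- The open half space `H_y = {z | (z - y) · Dg(y) > 0}`. -/
def halfSpace {n : ℕ} (g : EuclideanSpace ℝ (Fin n) → ℝ) (y : EuclideanSpace ℝ (Fin n)) :
    Set (EuclideanSpace ℝ (Fin n)) :=
  {z | 0 < inner ℝ (z - y) (∇ g y)}

/-- `E`: the points `y` with `Dg(y) ≠ 0` such that `g` takes a value below `g(y)` in `H_y`. -/
def strictSet {n : ℕ} (g : EuclideanSpace ℝ (Fin n) → ℝ) : Set (EuclideanSpace ℝ (Fin n)) :=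
  {y | ∇ g y ≠ 0 ∧ ∃ z ∈ halfSpace g y, g z < g y}

/-- The family of the path components of a subset `A` of a topological space. -/
def pathComponents {X : Type*} [TopologicalSpace X] (A : Set X) : Set (Set X) :=
  {C | ∃ x ∈ A, C = pathComponentIn A x}

/-- `F_i` for the path component `C = E_i` of `E`: the component together with the points
`y ∈ M \ E` such that the part `{z | g z > g y}` of some neighbourhood of `y` lies in `C`. -/
def extendedComponent {n : ℕ} (g : EuclideanSpace ℝ (Fin n) → ℝ)
    (C : Set (EuclideanSpace ℝ (Fin n))) : Set (EuclideanSpace ℝ (Fin n)) :=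
  C ∪ {y | y ∈ terminatingSet g \ strictSet g ∧ ∃ U ∈ 𝓝 y, U ∩ {z | g y < g z} ⊆ C}

end

end Eikonal

/-!
The proof follows the times at which a point `y` with `Dg(y) ≠ 0` minimizes `g` on the ball of
radius `t` that touches `y` from the side of `Dg(y)`. These balls increase with `t` and, apart from
`y`, each lies in the interior of the larger ones. So `y` is a minimizer up to `secondTime` and the
unique one up to `firstTime`, and in between there is an interior minimizer, which is a local
minimum of `g` with value `g y` (`exists_isLocalMin_of_firstTime_lt_secondTime`). As `g` has only
countably many local minimum values, the two times agree off countably many level sets of `g`.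

The second main ingredient is a strong form of semicontinuity. The Hessian bound at `y₀` that comes
with a touching ball gives strict local minimality in smaller balls for all points near `y₀`
(`CharMin.eventually_lt`). Together with compactness, this shows that both times tend to
`firstTime g y₀` when `y₀` is approached from higher levels, and to `secondTime g y₀` when it is
approached from lower levels. Along a curve on which `g` increases, the region between the two times
is therefore a graph with countably many downward jumps filled in, and such a set is an arc
(`IsFilledGraph.isPathConnected`): a weighted sum of jump functions maps it injectively and
continuously, hence homeomorphically, onto an interval.

Near a noncritical point, every point is joined to one common higher point by a segment along which
`g` increases (`exists_rising_segments`). Hence "all termination points of `y` and `z` can be joined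
in `T(F_i)`" is a locally constant relation on the component `E_i`, so it holds on all of `E_i`; the
points of `F_i \ E_i` are attached by segments that rise into `E_i`. The same segments show that
each point of `M \ E` belongs to some `F_i`. Finally, by Danskin's argument, the solution is
differentiable where all minimizers have the same gradient and only there (`mem_nondiffSet_iff`), so
`Σ ∪ T₁ = T(M)`. Countability holds because the `E_i` are disjoint open sets.
-/

namespace Eikonal

open Set Metric Filter

variable {n : ℕ} {g : EuclideanSpace ℝ (Fin n) → ℝ}

/-! ### Graphs with filled jumps -/

/-- The part of a continuous, injective "length" function that belongs to the jump at `v`: it runs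
from `0` at `(v, b)` to `1` at `(v, a)`, is `0` to the left and `1` to the right of `v`. -/
noncomputable def jumpFun (v a b : ℝ) (p : ℝ × ℝ) : ℝ :=
  if p.1 < v then 0 else if v < p.1 then 1 else (b - p.2) / (b - a)

/-- `α ≤ β` on `[0, 1]` are two functions whose one-sided limits agree: both tend to `β s` from the
left and to `α s` from the right of `s`. They differ at countably many points only. The conditions
are stated as one-sided estimates. -/
structure IsFilledGraph (α β : ℝ → ℝ) : Prop where
  le : ∀ s ∈ Icc (0 : ℝ) 1, α s ≤ β s
  countable : {s | s ∈ Icc (0 : ℝ) 1 ∧ α s < β s}.Countable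
  right_lower : ∀ s ∈ Icc (0 : ℝ) 1, ∀ t < α s, ∀ᶠ r in 𝓝 s, r ∈ Icc (0 : ℝ) 1 → s < r → t < α r
  right_upper : ∀ s ∈ Icc (0 : ℝ) 1, ∀ t > α s, ∀ᶠ r in 𝓝 s, r ∈ Icc (0 : ℝ) 1 → s < r → β r < t
  left_lower : ∀ s ∈ Icc (0 : ℝ) 1, ∀ t < β s, ∀ᶠ r in 𝓝 s, r ∈ Icc (0 : ℝ) 1 → r < s → t < α r
  left_upper : ∀ s ∈ Icc (0 : ℝ) 1, ∀ t > β s, ∀ᶠ r in 𝓝 s, r ∈ Icc (0 : ℝ) 1 → r < s → β r < t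

/-- The region between the two functions over `[0, 1]`. -/
def filledGraph (α β : ℝ → ℝ) : Set (ℝ × ℝ) :=
  {p | p.1 ∈ Icc (0 : ℝ) 1 ∧ α p.1 ≤ p.2 ∧ p.2 ≤ β p.1}

namespace IsFilledGraph

variable {α β : ℝ → ℝ}

theorem lower (h : IsFilledGraph α β) {s : ℝ} (hs : s ∈ Icc (0 : ℝ) 1) {t : ℝ} (ht : t < α s) :
    ∀ᶠ r in 𝓝 s, r ∈ Icc (0 : ℝ) 1 → t < α r := by
  filter_upwards [h.right_lower s hs t ht, h.left_lower s hs t (ht.trans_le (h.le s hs))]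
    with r h1 h2 hr
  rcases lt_trichotomy s r with h' | rfl | h'
  exacts [h1 hr h', ht, h2 hr h']

theorem upper (h : IsFilledGraph α β) {s : ℝ} (hs : s ∈ Icc (0 : ℝ) 1) {t : ℝ} (ht : β s < t) :
    ∀ᶠ r in 𝓝 s, r ∈ Icc (0 : ℝ) 1 → β r < t := by
  filter_upwards [h.right_upper s hs t ((h.le s hs).trans_lt ht), h.left_upper s hs t ht]
    with r h1 h2 hr
  rcases lt_trichotomy s r with h' | rfl | h'
  exacts [h1 hr h', ht, h2 hr h']

theorem isCompact (h : IsFilledGraph α β) : IsCompact (filledGraph α β) := by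
  have hne : (Icc (0 : ℝ) 1).Nonempty := ⟨0, by simp⟩
  obtain ⟨b, -, hb⟩ := UpperSemicontinuousOn.exists_isMaxOn (f := β) hne isCompact_Icc
    fun s hs t ht => eventually_nhdsWithin_iff.2 (h.upper hs ht)
  obtain ⟨a, -, ha⟩ := LowerSemicontinuousOn.exists_isMinOn (f := α) hne isCompact_Icc
    fun s hs t ht => eventually_nhdsWithin_iff.2 (h.lower hs ht)
  refine ((isCompact_Icc (a := (0 : ℝ)) (b := 1)).prod
    (isCompact_Icc (a := α a) (b := β b))).of_isClosed_subset ?_ ?_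
  · rw [← isOpen_compl_iff, isOpen_iff_mem_nhds]
    rintro ⟨s, t⟩ hst
    by_cases hs : s ∈ Icc (0 : ℝ) 1
    · by_cases h1 : α s ≤ t
      · have h2 : β s < t := not_le.1 fun h2 => hst ⟨hs, h1, h2⟩
        obtain ⟨m, hm1, hm2⟩ := exists_between h2
        filter_upwards [(h.upper hs hm1).prod_nhds (lt_mem_nhds hm2)] with p hp hp'
        exact (hp.2.trans_le hp'.2.2).not_gt (hp.1 hp'.1)
      · obtain ⟨m, hm1, hm2⟩ := exists_between (not_le.1 h1)
        filter_upwards [(h.lower hs hm2).prod_nhds (gt_mem_nhds hm1)] with p hp hp'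
        exact (hp'.2.1.trans_lt hp.2).not_gt (hp.1 hp'.1)
    · have : {p : ℝ × ℝ | p.1 ∉ Icc (0 : ℝ) 1} ∈ 𝓝 (s, t) :=
        (isClosed_Icc.isOpen_compl.preimage continuous_fst).mem_nhds hs
      filter_upwards [this] with p hp hp'
      exact hp hp'.1
  · rintro ⟨s, t⟩ ⟨hs, h1, h2⟩
    exact ⟨hs, (ha hs).trans h1, h2.trans (hb hs)⟩

theorem isConnected (h : IsFilledGraph α β) : IsConnected (univ : Set (filledGraph α β)) := by
  have : CompactSpace (filledGraph α β) := isCompact_iff_compactSpace.1 h.isCompact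
  let π : filledGraph α β → Icc (0 : ℝ) 1 := fun p => ⟨p.1.1, p.2.1⟩
  have hπ : Continuous π := by fun_prop
  have hfib : ∀ s, IsConnected (π ⁻¹' {s}) := by
    intro s
    have himg : Subtype.val '' (π ⁻¹' {s}) = (fun t => (s.1, t)) '' Icc (α s) (β s) := by
      ext ⟨r, t⟩
      constructor
      · rintro ⟨⟨⟨r', t'⟩, hp⟩, hs, heq⟩
        have : r' = s := congrArg Subtype.val hs
        subst this
        obtain ⟨rfl, rfl⟩ := Prod.mk.inj heq
        exact ⟨t', hp.2, rfl⟩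
      · rintro ⟨t', ht, heq⟩
        obtain ⟨rfl, rfl⟩ := Prod.mk.inj heq
        exact ⟨⟨(s.1, t'), s.2, ht⟩, rfl, rfl⟩
    have hc : IsConnected ((fun t => (s.1, t)) '' Icc (α s) (β s)) :=
      (isConnected_Icc (h.le s s.2)).image _ (by fun_prop)
    rw [← himg] at hc
    exact ⟨hc.1.of_image, (Topology.IsInducing.subtypeVal.isPreconnected_image).1 hc.2⟩
  have hsurj : Function.Surjective π := fun s => (hfib s).1.imp fun p hp => hp
  have hq := hπ.isClosedMap.isQuotientMap hπ hsurj
  have := hq.isCoinducing.isConnected_preimage_of_isClosed hfib isClosed_univ isConnected_univ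
  simpa using this

theorem continuous_jumpFun (h : IsFilledGraph α β) {v : ℝ} (hv : v ∈ Icc (0 : ℝ) 1)
    (hlt : α v < β v) : Continuous fun p : filledGraph α β => jumpFun v (α v) (β v) p := by
  have hba : 0 < β v - α v := sub_pos.2 hlt
  let l : ℝ × ℝ → ℝ := fun p => (β v - p.2) / (β v - α v)
  have hl : Continuous l := by fun_prop
  refine continuous_iff_continuousAt.2 fun ⟨⟨s, t⟩, hs, h1, h2⟩ => ?_
  have hval : Tendsto (Subtype.val : filledGraph α β → ℝ × ℝ) (𝓝 ⟨(s, t), hs, h1, h2⟩)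
    (𝓝 s ×ˢ 𝓝 t) := nhds_prod_eq (x := s) (y := t) ▸ continuous_subtype_val.continuousAt
  have hfst := tendsto_fst.comp hval
  have hsnd := tendsto_snd.comp hval
  -- Near `(s, t)` the function takes its value at `(s, t)` or agrees with an affine function.
  have key : ∀ᶠ p : filledGraph α β in 𝓝 ⟨(s, t), hs, h1, h2⟩,
      jumpFun v (α v) (β v) p = jumpFun v (α v) (β v) (s, t) ∨
        s = v ∧ jumpFun v (α v) (β v) p = l p := by
    rcases lt_trichotomy s v with hsv | rfl | hsv
    · filter_upwards [hfst.eventually (gt_mem_nhds hsv)] with p hp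
      exact Or.inl ((if_pos hp).trans (if_pos hsv).symm)
    · have hst : jumpFun s (α s) (β s) (s, t) = l (s, t) := by simp [jumpFun, l]
      have hleft : ∀ᶠ p : filledGraph α β in 𝓝 ⟨(s, t), hs, h1, h2⟩,
          p.1.1 < s → l (s, t) = 0 := by
        rcases (show t ≤ β s from h2).eq_or_lt with rfl | ht
        · exact Eventually.of_forall fun _ _ => by simp [l]
        · obtain ⟨m, hm1, hm2⟩ := exists_between ht
          filter_upwards [hfst.eventually (h.left_lower s hs m hm2),
            hsnd.eventually (gt_mem_nhds hm1)] with p hp1 hp2 hp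
          exact absurd (p.2.2.1.trans_lt hp2) (hp1 p.2.1 hp).not_gt
      have hright : ∀ᶠ p : filledGraph α β in 𝓝 ⟨(s, t), hs, h1, h2⟩,
          s < p.1.1 → l (s, t) = 1 := by
        rcases (show α s ≤ t from h1).eq_or_lt with rfl | ht
        · exact Eventually.of_forall fun _ _ => div_self hba.ne'
        · obtain ⟨m, hm1, hm2⟩ := exists_between ht
          filter_upwards [hfst.eventually (h.right_upper s hs m hm1),
            hsnd.eventually (lt_mem_nhds hm2)] with p hp1 hp2 hp
          exact absurd (hp2.trans_le p.2.2.2) (hp1 p.2.1 hp).not_gt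
      filter_upwards [hleft, hright] with p hp1 hp2
      rcases lt_trichotomy p.1.1 s with hp | hp | hp
      · exact Or.inl (by rw [hst, hp1 hp]; exact if_pos hp)
      · exact Or.inr ⟨rfl, by simp [jumpFun, l, hp]⟩
      · exact Or.inl (by rw [hst, hp2 hp]; exact (if_neg hp.not_gt).trans (if_pos hp))
    · filter_upwards [hfst.eventually (lt_mem_nhds hsv)] with p hp
      refine Or.inl ?_
      have hp' : v < p.1.1 := hp
      simp [jumpFun, hp', hp'.not_gt, hsv, hsv.not_gt]
  refine tendsto_iff_eventually.2 fun {P} hP => ?_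
  have hP0 : P (jumpFun v (α v) (β v) (s, t)) := hP.self_of_nhds
  by_cases hsv : s = v
  · subst hsv
    have hst : jumpFun s (α s) (β s) (s, t) = l (s, t) := by simp [jumpFun, l]
    have hlP : ∀ᶠ p : filledGraph α β in 𝓝 ⟨(s, t), hs, h1, h2⟩, P (l p) :=
      (hl.comp continuous_subtype_val).continuousAt.eventually (by simpa [hst] using hP)
    filter_upwards [key, hlP] with p hp hpP
    rcases hp with hp | ⟨-, hp⟩
    · simpa [hp] using hP0
    · simpa [hp] using hpP
  · filter_upwards [key] with p hp
    rcases hp with hp | ⟨hp, -⟩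
    · simpa [hp] using hP0
    · exact absurd hp hsv

theorem jumpFun_mem_Icc {v : ℝ} (hlt : α v < β v) {p : ℝ × ℝ} (hp : p ∈ filledGraph α β) :
    jumpFun v (α v) (β v) p ∈ Icc (0 : ℝ) 1 := by
  have hba : 0 < β v - α v := sub_pos.2 hlt
  unfold jumpFun
  split_ifs with h1 h2
  · simp
  · simp
  · have h3 : p.1 = v := le_antisymm (not_lt.1 h2) (not_lt.1 h1)
    have h4 := hp.2
    rw [h3] at h4
    exact ⟨div_nonneg (by linarith) hba.le, (div_le_one hba).2 (by linarith)⟩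

theorem jumpFun_mono {v : ℝ} (hlt : α v < β v) {p q : ℝ × ℝ} (hp : p ∈ filledGraph α β)
    (hq : q ∈ filledGraph α β) (hpq : p.1 < q.1) :
    jumpFun v (α v) (β v) p ≤ jumpFun v (α v) (β v) q := by
  rcases lt_or_ge p.1 v with h1 | h1
  · exact (if_pos h1).trans_le (jumpFun_mem_Icc hlt hq).1
  · have h2 : v < q.1 := h1.trans_lt hpq
    exact (jumpFun_mem_Icc hlt hp).2.trans_eq (by simp [jumpFun, h2, h2.not_gt])

/-- The filled graph is an arc: the abscissa plus a weighted sum of the jump functions maps it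
homeomorphically onto an interval. -/
theorem isPathConnected (h : IsFilledGraph α β) : IsPathConnected (filledGraph α β) := by
  have : CompactSpace (filledGraph α β) := isCompact_iff_compactSpace.1 h.isCompact
  let J := {s | s ∈ Icc (0 : ℝ) 1 ∧ α s < β s}
  have : Countable J := h.countable.to_subtype
  have : Encodable J := Encodable.ofCountable J
  let w : J → ℝ := fun v => (1 / 2) ^ Encodable.encode v
  have hw : ∀ v, 0 < w v := fun v => by positivity
  have hws : Summable w := summable_geometric_two_encode
  let f : J → ℝ × ℝ → ℝ := fun v p => w v * jumpFun v (α v) (β v) p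
  have hbound : ∀ (v : J) (p : filledGraph α β), ‖f v p‖ ≤ w v := by
    intro v p
    obtain ⟨h0, h1⟩ := jumpFun_mem_Icc v.2.2 p.2
    rw [Real.norm_of_nonneg (mul_nonneg (hw v).le h0)]
    exact mul_le_of_le_one_right (hw v).le h1
  have hsum : ∀ p : filledGraph α β, Summable fun v => f v p := fun p =>
    hws.of_norm_bounded (fun v => hbound v p)
  let F : filledGraph α β → ℝ := fun p => p.1.1 + ∑' v, f v p
  have hF : Continuous F := (continuous_fst.comp continuous_subtype_val).add
    (continuous_tsum (fun v => continuous_const.mul (h.continuous_jumpFun v.2.1 v.2.2)) hws hbound)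
  have hfst : ∀ p q : filledGraph α β, p.1.1 < q.1.1 → F p < F q := fun p q hpq =>
    add_lt_add_of_lt_of_le hpq ((hsum p).tsum_le_tsum
      (fun v => mul_le_mul_of_nonneg_left (jumpFun_mono v.2.2 p.2 q.2 hpq) (hw v).le) (hsum q))
  have hsnd : ∀ p q : filledGraph α β, p.1.1 = q.1.1 → p.1.2 < q.1.2 → F q < F p := by
    intro p q hpq hlt
    have hv : α p.1.1 < β p.1.1 := by
      have := q.2.2.2
      rw [← hpq] at this
      exact p.2.2.1.trans_lt (hlt.trans_le this)
    refine add_lt_add_of_le_of_lt hpq.ge ((hsum q).tsum_lt_tsum (i := ⟨p.1.1, p.2.1, hv⟩)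
      (fun v => ?_) ?_ (hsum p))
    · refine mul_le_mul_of_nonneg_left ?_ (hw v).le
      have hba : 0 < β v - α v := sub_pos.2 v.2.2
      simp only [jumpFun, hpq]
      split_ifs
      · exact le_rfl
      · exact le_rfl
      · gcongr
    · refine mul_lt_mul_of_pos_left ?_ (hw _)
      have hba : 0 < β p.1.1 - α p.1.1 := sub_pos.2 hv
      simp only [jumpFun, hpq, lt_irrefl, if_false]
      rw [hpq] at hba
      gcongr
  have hinj : Function.Injective F := by
    intro p q hpq
    have h1 : p.1.1 = q.1.1 := by
      rcases lt_trichotomy p.1.1 q.1.1 with h' | h' | h'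
      exacts [absurd hpq (hfst p q h').ne, h', absurd hpq (hfst q p h').ne']
    refine Subtype.ext (Prod.ext h1 ?_)
    rcases lt_trichotomy p.1.2 q.1.2 with h' | h' | h'
    exacts [absurd hpq (hsnd p q h1 h').ne', h', absurd hpq (hsnd q p h1.symm h').ne]
  have hconn : IsConnected (F '' univ) := h.isConnected.image F hF.continuousOn
  have hpath : IsPathConnected (univ : Set (filledGraph α β)) :=
    (hF.isClosedEmbedding hinj).isInducing.isPathConnected_iff.2
      (hconn.2.ordConnected.convex.isPathConnected hconn.1)
  simpa using hpath.image continuous_subtype_val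

end IsFilledGraph

/-! ### Minimizers on a characteristic -/

/-- `y` is a minimizer for the point of its characteristic at time `t`, in unfolded form. -/
def CharMin {n : ℕ} (g : EuclideanSpace ℝ (Fin n) → ℝ) (y : EuclideanSpace ℝ (Fin n)) (t : ℝ) :
    Prop :=
  ∀ z ∈ closedBall (charPoint g y t) t, g y ≤ g z

/-- `y` is the unique minimizer for the point of its characteristic at time `t`, in unfolded
form. -/
def StrictCharMin {n : ℕ} (g : EuclideanSpace ℝ (Fin n) → ℝ) (y : EuclideanSpace ℝ (Fin n))
    (t : ℝ) : Prop :=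
  ∀ z ∈ closedBall (charPoint g y t) t, z ≠ y → g y < g z

theorem StrictCharMin.charMin {y : EuclideanSpace ℝ (Fin n)} {t : ℝ} (h : StrictCharMin g y t) :
    CharMin g y t := fun z hz => by
  rcases eq_or_ne z y with rfl | hne
  · exact le_rfl
  · exact (h z hz hne).le

theorem mem_minimizers_iff (hg : Continuous g) {x y : EuclideanSpace ℝ (Fin n)} {t : ℝ}
    (ht : 0 ≤ t) :
    y ∈ minimizers g x t ↔ y ∈ closedBall x t ∧ ∀ z ∈ closedBall x t, g y ≤ g z := by
  have hL := hopfLax_isLeast hg x ht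
  refine ⟨fun h => ⟨h.1, fun z hz => h.2 ▸ hL.2 (mem_image_of_mem g hz)⟩, fun h => ⟨h.1, ?_⟩⟩
  exact hL.unique ⟨mem_image_of_mem g h.1, forall_mem_image.2 h.2⟩

theorem nonempty_minimizers (hg : Continuous g) (x : EuclideanSpace ℝ (Fin n)) {t : ℝ}
    (ht : 0 ≤ t) : (minimizers g x t).Nonempty := by
  obtain ⟨y, hy, h⟩ := (hopfLax_isLeast hg x ht).1
  exact ⟨y, hy, h.symm⟩

theorem norm_unit_le_one (p : EuclideanSpace ℝ (Fin n)) : ‖‖p‖⁻¹ • p‖ ≤ 1 := by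
  rcases eq_or_ne p 0 with rfl | hp
  · simp
  · rw [norm_smul, norm_inv, norm_norm, inv_mul_cancel₀ (norm_ne_zero_iff.2 hp)]

theorem dist_charPoint_le (g : EuclideanSpace ℝ (Fin n) → ℝ) (y : EuclideanSpace ℝ (Fin n))
    {s t : ℝ} (hst : s ≤ t) : dist (charPoint g y s) (charPoint g y t) ≤ t - s := by
  rw [dist_comm, charPoint, charPoint, dist_add_left, dist_eq_norm, ← sub_smul, norm_smul,
    Real.norm_of_nonneg (sub_nonneg.2 hst)]
  exact mul_le_of_le_one_right (sub_nonneg.2 hst) (norm_unit_le_one _)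

@[simp] theorem charPoint_zero (g : EuclideanSpace ℝ (Fin n) → ℝ)
    (y : EuclideanSpace ℝ (Fin n)) : charPoint g y 0 = y := by simp [charPoint]

theorem self_mem_closedBall_charPoint (g : EuclideanSpace ℝ (Fin n) → ℝ)
    (y : EuclideanSpace ℝ (Fin n)) {t : ℝ} (ht : 0 ≤ t) : y ∈ closedBall (charPoint g y t) t := by
  simpa using dist_charPoint_le g y ht

theorem closedBall_charPoint_subset (g : EuclideanSpace ℝ (Fin n) → ℝ)
    (y : EuclideanSpace ℝ (Fin n)) {s t : ℝ} (hst : s ≤ t) :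
    closedBall (charPoint g y s) s ⊆ closedBall (charPoint g y t) t :=
  closedBall_subset_closedBall' (by linarith [dist_charPoint_le g y hst])

theorem CharMin.anti {y : EuclideanSpace ℝ (Fin n)} {s t : ℝ} (h : CharMin g y t) (hst : s ≤ t) :
    CharMin g y s := fun z hz => h z (closedBall_charPoint_subset g y hst hz)

theorem StrictCharMin.anti {y : EuclideanSpace ℝ (Fin n)} {s t : ℝ} (h : StrictCharMin g y t)
    (hst : s ≤ t) : StrictCharMin g y s :=
  fun z hz => h z (closedBall_charPoint_subset g y hst hz)

theorem mem_minimizers_charPoint_iff (hg : Continuous g) {y : EuclideanSpace ℝ (Fin n)} {t : ℝ}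
    (ht : 0 ≤ t) : y ∈ minimizers g (charPoint g y t) t ↔ CharMin g y t := by
  rw [mem_minimizers_iff hg ht]
  exact and_iff_right (self_mem_closedBall_charPoint g y ht)

theorem minimizers_eq_singleton_iff (hg : Continuous g) {y : EuclideanSpace ℝ (Fin n)} {t : ℝ}
    (ht : 0 ≤ t) : minimizers g (charPoint g y t) t = {y} ↔ StrictCharMin g y t := by
  constructor
  · intro h z hz hne
    have hy : CharMin g y t := (mem_minimizers_charPoint_iff hg ht).1 (h ▸ mem_singleton y)
    refine lt_of_not_ge fun hle => hne ?_
    have : z ∈ minimizers g (charPoint g y t) t :=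
      (mem_minimizers_iff hg ht).2 ⟨hz, fun w hw => hle.trans (hy w hw)⟩
    rwa [h] at this
  · intro h
    refine eq_singleton_iff_unique_mem.2 ⟨(mem_minimizers_charPoint_iff hg ht).2 h.charMin, ?_⟩
    intro z hz
    by_contra hne
    have h1 := h z hz.1 hne
    exact absurd (((mem_minimizers_iff hg ht).1 hz).2 y (self_mem_closedBall_charPoint g y ht))
      h1.not_ge

/-- In terms of the displacement from `y`, the ball that touches `y` along the characteristic is
the superlevel set of a quadratic function. -/
theorem norm_sub_charPoint_sq {y : EuclideanSpace ℝ (Fin n)} (hy : ∇ g y ≠ 0) (z) (t : ℝ) :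
    ‖∇ g y‖ * ‖z - charPoint g y t‖ ^ 2 =
      ‖∇ g y‖ * ‖z - y‖ ^ 2 - 2 * t * inner ℝ (z - y) (∇ g y) + ‖∇ g y‖ * t ^ 2 := by
  have hp : ‖∇ g y‖ ≠ 0 := norm_ne_zero_iff.2 hy
  have : z - charPoint g y t = (z - y) - (t * ‖∇ g y‖⁻¹) • ∇ g y := by
    rw [charPoint, smul_smul]; abel
  rw [this, norm_sub_sq_real, norm_smul, inner_smul_right, mul_pow, Real.norm_eq_abs, sq_abs]
  field_simp

theorem mem_closedBall_charPoint_iff {y : EuclideanSpace ℝ (Fin n)} (hy : ∇ g y ≠ 0)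
    {z : EuclideanSpace ℝ (Fin n)} {t : ℝ} (ht : 0 ≤ t) :
    z ∈ closedBall (charPoint g y t) t ↔
      ‖∇ g y‖ * ‖z - y‖ ^ 2 ≤ 2 * t * inner ℝ (z - y) (∇ g y) := by
  have hp : 0 < ‖∇ g y‖ := norm_pos_iff.2 hy
  rw [mem_closedBall_iff_norm, ← sq_le_sq₀ (norm_nonneg _) ht, ← mul_le_mul_iff_right₀ hp,
    norm_sub_charPoint_sq hy]
  constructor <;> intro h <;> linarith

theorem mem_ball_charPoint_iff {y : EuclideanSpace ℝ (Fin n)} (hy : ∇ g y ≠ 0)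
    {z : EuclideanSpace ℝ (Fin n)} {t : ℝ} (ht : 0 ≤ t) :
    z ∈ ball (charPoint g y t) t ↔
      ‖∇ g y‖ * ‖z - y‖ ^ 2 < 2 * t * inner ℝ (z - y) (∇ g y) := by
  have hp : 0 < ‖∇ g y‖ := norm_pos_iff.2 hy
  rw [mem_ball_iff_norm, ← sq_lt_sq₀ (norm_nonneg _) ht, ← mul_lt_mul_iff_right₀ hp,
    norm_sub_charPoint_sq hy]
  constructor <;> intro h <;> linarith

theorem inner_pos_of_mem_closedBall {y : EuclideanSpace ℝ (Fin n)} (hy : ∇ g y ≠ 0)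
    {z : EuclideanSpace ℝ (Fin n)} (hz : z ≠ y) {t : ℝ} (ht : 0 ≤ t)
    (h : z ∈ closedBall (charPoint g y t) t) : 0 < inner ℝ (z - y) (∇ g y) := by
  have h1 := (mem_closedBall_charPoint_iff hy ht).1 h
  have h2 : 0 < ‖∇ g y‖ * ‖z - y‖ ^ 2 :=
    mul_pos (norm_pos_iff.2 hy) (pow_pos (norm_pos_iff.2 (sub_ne_zero.2 hz)) 2)
  exact pos_of_mul_pos_right (h2.trans_le h1) (by linarith)

theorem mem_ball_charPoint_of_lt {y : EuclideanSpace ℝ (Fin n)} (hy : ∇ g y ≠ 0)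
    {z : EuclideanSpace ℝ (Fin n)} (hz : z ≠ y) {s t : ℝ} (hs : 0 ≤ s) (hst : s < t)
    (h : z ∈ closedBall (charPoint g y s) s) : z ∈ ball (charPoint g y t) t := by
  have h1 := (mem_closedBall_charPoint_iff hy hs).1 h
  have h2 := inner_pos_of_mem_closedBall hy hz hs h
  exact (mem_ball_charPoint_iff hy (hs.trans hst.le)).2 (by nlinarith)

/-- A point of the open half space of `y` lies in the touching balls of large radius. -/
theorem exists_mem_closedBall_charPoint {y : EuclideanSpace ℝ (Fin n)}
    {z : EuclideanSpace ℝ (Fin n)} (hz : z ∈ halfSpace g y) :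
    ∃ t, 0 < t ∧ z ∈ closedBall (charPoint g y t) t := by
  have hz' : 0 < inner ℝ (z - y) (∇ g y) := hz
  have hy : ∇ g y ≠ 0 := by rintro h; simp [h] at hz'
  refine ⟨‖∇ g y‖ * ‖z - y‖ ^ 2 / (2 * inner ℝ (z - y) (∇ g y)) + 1, by positivity, ?_⟩
  rw [mem_closedBall_charPoint_iff hy (by positivity)]
  have : 2 * (‖∇ g y‖ * ‖z - y‖ ^ 2 / (2 * inner ℝ (z - y) (∇ g y)) + 1) *
      inner ℝ (z - y) (∇ g y) = ‖∇ g y‖ * ‖z - y‖ ^ 2 + 2 * inner ℝ (z - y) (∇ g y) := by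
    field_simp
  rw [this]; linarith

/-! ### The termination times -/

theorem StrictCharMin.le_firstTime (hg : Continuous g) {y : EuclideanSpace ℝ (Fin n)} {t : ℝ}
    (ht : 0 < t) (h : StrictCharMin g y t) : ENNReal.ofReal t ≤ firstTime g y :=
  le_sSup (mem_image_of_mem _ ⟨ht, (minimizers_eq_singleton_iff hg ht.le).2 h⟩)

theorem strictCharMin_of_lt_firstTime (hg : Continuous g) {y : EuclideanSpace ℝ (Fin n)} {t : ℝ}
    (h : ENNReal.ofReal t < firstTime g y) : StrictCharMin g y t := by
  obtain ⟨_, ⟨s, ⟨hs, hs'⟩, rfl⟩, hlt⟩ := lt_sSup_iff.1 h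
  exact ((minimizers_eq_singleton_iff hg hs.le).1 hs').anti
    (ENNReal.ofReal_lt_ofReal_iff hs |>.1 hlt).le

theorem charMin_of_lt_secondTime (hg : Continuous g) {y : EuclideanSpace ℝ (Fin n)} {t : ℝ}
    (ht : 0 < t) (h : ENNReal.ofReal t < secondTime g y) : CharMin g y t := by
  by_contra hc
  exact h.not_ge (sInf_le (mem_image_of_mem _
    ⟨ht, fun h' => hc ((mem_minimizers_charPoint_iff hg ht.le).1 h')⟩))

theorem secondTime_le_of_not_charMin (hg : Continuous g) {y : EuclideanSpace ℝ (Fin n)} {t : ℝ}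
    (ht : 0 < t) (h : ¬ CharMin g y t) : secondTime g y ≤ ENNReal.ofReal t :=
  sInf_le (mem_image_of_mem _ ⟨ht, fun h' => h ((mem_minimizers_charPoint_iff hg ht.le).1 h')⟩)

theorem CharMin.le_secondTime (hg : Continuous g) {y : EuclideanSpace ℝ (Fin n)} {t : ℝ}
    (h : CharMin g y t) : ENNReal.ofReal t ≤ secondTime g y := by
  refine le_sInf (forall_mem_image.2 fun s hs => ENNReal.ofReal_le_ofReal ?_)
  by_contra hlt
  exact hs.2 ((mem_minimizers_charPoint_iff hg hs.1.le).2 (h.anti (not_le.1 hlt).le))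

theorem firstTime_le_secondTime (hg : Continuous g) (y : EuclideanSpace ℝ (Fin n)) :
    firstTime g y ≤ secondTime g y :=
  sSup_le (forall_mem_image.2 fun _ ht =>
    ((minimizers_eq_singleton_iff hg ht.1.le).1 ht.2).charMin.le_secondTime hg)

theorem firstTime_le_of_not_strictCharMin (hg : Continuous g) {y : EuclideanSpace ℝ (Fin n)}
    {t : ℝ} (h : ¬ StrictCharMin g y t) : firstTime g y ≤ ENNReal.ofReal t := by
  by_contra hlt
  exact h (strictCharMin_of_lt_firstTime hg (not_le.1 hlt))

theorem not_strictCharMin_of_firstTime_lt (hg : Continuous g) {y : EuclideanSpace ℝ (Fin n)}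
    {t : ℝ} (ht : 0 < t) (h : firstTime g y < ENNReal.ofReal t) : ¬ StrictCharMin g y t :=
  fun h' => h.not_ge (h'.le_firstTime hg ht)

/-- The minimizing times form a closed set: `y` is still a minimizer at its second termination
time. -/
theorem charMin_of_le_secondTime (hg : Continuous g) {y : EuclideanSpace ℝ (Fin n)}
    (hy : ∇ g y ≠ 0) {t : ℝ} (ht : 0 < t)
    (h : ENNReal.ofReal t ≤ secondTime g y) : CharMin g y t := by
  have hball : ∀ z ∈ ball (charPoint g y t) t, g y ≤ g z := by
    intro z hz
    rw [mem_ball_charPoint_iff hy ht.le] at hz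
    have hc : ∀ᶠ s in 𝓝[<] t, ‖∇ g y‖ * ‖z - y‖ ^ 2 < 2 * s * inner ℝ (z - y) (∇ g y) := by
      apply eventually_nhdsWithin_of_eventually_nhds
      have hcont : Continuous fun s : ℝ => 2 * s * inner ℝ (z - y) (∇ g y) := by fun_prop
      exact hcont.continuousAt.eventually (lt_mem_nhds hz)
    obtain ⟨s, ⟨hs1, hs2⟩, hs0⟩ := ((hc.and self_mem_nhdsWithin).and
      (eventually_nhdsWithin_of_eventually_nhds (lt_mem_nhds ht))).exists
    refine charMin_of_lt_secondTime hg hs0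
      (((ENNReal.ofReal_lt_ofReal_iff ht).2 hs2).trans_le h) z ?_
    exact (mem_closedBall_charPoint_iff hy hs0.le).2 hs1.le
  intro z hz
  rw [← closure_ball _ ht.ne'] at hz
  exact closure_minimal (t := {z | g y ≤ g z}) hball (isClosed_le continuous_const hg) hz

theorem mem_terminationPoints_iff (hg : Continuous g) {S : Set (EuclideanSpace ℝ (Fin n))}
    (hS : ∀ y ∈ S, ∇ g y ≠ 0) {p : EuclideanSpace ℝ (Fin n) × ℝ} :
    p ∈ terminationPoints g S ↔ 0 < p.2 ∧ ∃ y ∈ S, p.1 = charPoint g y p.2 ∧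
      firstTime g y ≤ ENNReal.ofReal p.2 ∧ CharMin g y p.2 := by
  refine and_congr_right fun hp => exists_congr fun y => and_congr_right fun hy =>
    and_congr_right fun _ => and_congr_right fun _ => ?_
  exact ⟨charMin_of_le_secondTime hg (hS y hy) hp, fun h => h.le_secondTime hg⟩

theorem secondTime_lt_top (hg : Continuous g) {y : EuclideanSpace ℝ (Fin n)}
    (hy : y ∈ strictSet g) : secondTime g y < ⊤ := by
  obtain ⟨-, z, hz, hlt⟩ := hy
  obtain ⟨t, ht, hzt⟩ := exists_mem_closedBall_charPoint hz
  exact (secondTime_le_of_not_charMin hg ht fun h => hlt.not_ge (h z hzt)).trans_lt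
    ENNReal.ofReal_lt_top

theorem strictSet_subset_terminatingSet (hg : Continuous g) :
    strictSet g ⊆ terminatingSet g := fun y hy =>
  ⟨hy.1, (firstTime_le_secondTime hg y).trans_lt (secondTime_lt_top hg hy)⟩

theorem extendedComponent_subset_terminatingSet (hg : Continuous g)
    {C : Set (EuclideanSpace ℝ (Fin n))} (hC : C ⊆ strictSet g) :
    extendedComponent g C ⊆ terminatingSet g :=
  union_subset (hC.trans (strictSet_subset_terminatingSet hg)) fun _ hy => hy.1.1

theorem terminationPoints_mono {S S' : Set (EuclideanSpace ℝ (Fin n))} (h : S ⊆ S') :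
    terminationPoints g S ⊆ terminationPoints g S' :=
  fun _ ⟨hp, y, hy, h'⟩ => ⟨hp, y, h hy, h'⟩

/-- For `y` with finite first termination time there is a second point, in the half space of
`y`, at which `g` is at most `g y`. -/
theorem exists_halfSpace_le {y : EuclideanSpace ℝ (Fin n)}
    (hg : Continuous g) (hy : y ∈ terminatingSet g) : ∃ z ∈ halfSpace g y, g z ≤ g y := by
  obtain ⟨t, ht⟩ : ∃ t : ℝ, firstTime g y < ENNReal.ofReal t := by
    obtain ⟨r, hr, -⟩ := ENNReal.lt_iff_exists_nnreal_btwn.1 hy.2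
    exact ⟨r, by simpa using hr⟩
  have ht0 : 0 < t := ENNReal.ofReal_pos.1 (bot_le.trans_lt ht)
  have := not_strictCharMin_of_firstTime_lt hg ht0 ht
  simp only [StrictCharMin, not_forall, not_lt] at this
  obtain ⟨z, hz, hne, hle⟩ := this
  exact ⟨z, inner_pos_of_mem_closedBall hy.1 hne ht0.le hz, hle⟩

/-- Strictly between the two termination times the minimum is also attained in the interior of
the ball, so `g y` is a local minimum value of `g`. -/
theorem exists_isLocalMin_of_firstTime_lt_secondTime (hg : Continuous g)
    {y : EuclideanSpace ℝ (Fin n)} (hy : ∇ g y ≠ 0) (h : firstTime g y < secondTime g y) :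
    ∃ z, IsLocalMin g z ∧ g z = g y := by
  obtain ⟨s, hs1, hs2⟩ := ENNReal.lt_iff_exists_nnreal_btwn.1 h
  obtain ⟨t, ht1, ht2⟩ := ENNReal.lt_iff_exists_nnreal_btwn.1 hs2
  have hs0 : (0 : ℝ) < s := by
    have := bot_le.trans_lt hs1; simpa using this
  have hst : (s : ℝ) < t := by exact_mod_cast ht1
  have h1 : ¬ StrictCharMin g y s := not_strictCharMin_of_firstTime_lt hg hs0 (by simpa using hs1)
  have h2 : CharMin g y t := charMin_of_lt_secondTime hg (hs0.trans hst) (by simpa using ht2)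
  simp only [StrictCharMin, not_forall, not_lt] at h1
  obtain ⟨z, hz, hne, hle⟩ := h1
  have hzb := mem_ball_charPoint_of_lt hy hne hs0.le hst hz
  have hzy : g z = g y := le_antisymm hle (h2 z (ball_subset_closedBall hzb))
  refine ⟨z, ?_, hzy⟩
  filter_upwards [isOpen_ball.mem_nhds hzb] with w hw
  exact hzy ▸ h2 w (ball_subset_closedBall hw)

/-- A function on a second countable space has countably many local minimum values: each is the
infimum over a member of a countable basis. -/
theorem countable_localMin_values {X : Type*} [TopologicalSpace X] [SecondCountableTopology X]
    (f : X → ℝ) : {c | ∃ z, IsLocalMin f z ∧ f z = c}.Countable := by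
  refine ((TopologicalSpace.countable_countableBasis X).image fun b => sInf (f '' b)).mono ?_
  rintro _ ⟨z, hz, rfl⟩
  obtain ⟨b, hb, hzb, hsub⟩ :=
    (TopologicalSpace.isBasis_countableBasis X).mem_nhds_iff.1 hz
  refine ⟨b, hb, IsLeast.csInf_eq ⟨mem_image_of_mem f hzb, forall_mem_image.2 fun w hw => hsub hw⟩⟩

theorem isOpen_strictSet (hg : Continuous g) (hg' : Continuous (∇ g)) :
    IsOpen (strictSet g) := by
  have : strictSet g = {y | ∇ g y ≠ 0} ∩ ⋃ z, {y | 0 < inner ℝ (z - y) (∇ g y) ∧ g z < g y} := by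
    ext y; simp [strictSet, halfSpace]
  rw [this]
  refine (isOpen_ne_fun hg' continuous_const).inter (isOpen_iUnion fun z => ?_)
  have hinner : Continuous fun y => inner ℝ (z - y) (∇ g y) :=
    (continuous_const.sub continuous_id).inner hg'
  exact (isOpen_lt continuous_const hinner).inter (isOpen_lt continuous_const hg)

/-! ### Second-order estimates -/

theorem contDiff_gradient (hg : ContDiff ℝ 2 g) : ContDiff ℝ 1 (∇ g) :=
  (InnerProductSpace.toDual ℝ (EuclideanSpace ℝ (Fin n))).symm.contDiff.comp
    (hg.fderiv_right (m := 1) (by norm_num))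

theorem continuous_gradient (hg : ContDiff ℝ 2 g) : Continuous (∇ g) :=
  (contDiff_gradient hg).continuous

theorem hasFDerivAt_innerSL_gradient (hg : ContDiff ℝ 2 g) (y : EuclideanSpace ℝ (Fin n)) :
    HasFDerivAt g (innerSL ℝ (∇ g y)) y := by
  have h := ((hg.differentiable (by norm_num)) y).hasFDerivAt
  have heq : innerSL ℝ (∇ g y) = fderiv ℝ g y := by
    ext w
    rw [innerSL_apply_apply, inner_gradient_left]
  rwa [heq]

/-- Second-order Taylor expansion of `g` about `y`, with an error that is uniform for `y` near `y₀`
and the Hessian taken at the fixed point `y₀`. -/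
theorem eventually_taylor (hg : ContDiff ℝ 2 g) (y₀ : EuclideanSpace ℝ (Fin n)) {ε : ℝ}
    (hε : 0 < ε) :
    ∀ᶠ q : EuclideanSpace ℝ (Fin n) × EuclideanSpace ℝ (Fin n) in 𝓝 (y₀, y₀),
      |g q.2 - g q.1 - inner ℝ (q.2 - q.1) (∇ g q.1) -
        1 / 2 * inner ℝ (fderiv ℝ (∇ g) y₀ (q.2 - q.1)) (q.2 - q.1)| ≤ ε * ‖q.2 - q.1‖ ^ 2 := by
  have hs := ((contDiff_gradient hg).contDiffAt (x := y₀)).hasStrictFDerivAt (by norm_num)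
  set A := fderiv ℝ (∇ g) y₀
  have hev : ∀ᶠ p : EuclideanSpace ℝ (Fin n) × EuclideanSpace ℝ (Fin n) in 𝓝 (y₀, y₀),
      ‖∇ g p.1 - ∇ g p.2 - A (p.1 - p.2)‖ ≤ ε * ‖p.1 - p.2‖ := hs.isLittleO.def hε
  obtain ⟨ρ, hρ, hsub⟩ := Metric.eventually_nhds_iff_ball.1 hev
  have hsub' : ∀ y ∈ ball y₀ ρ, ∀ z ∈ ball y₀ ρ,
      ‖∇ g z - ∇ g y - A (z - y)‖ ≤ ε * ‖z - y‖ := by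
    intro y hy z hz
    refine hsub (z, y) ?_
    rw [← ball_prod_same]
    exact ⟨hz, hy⟩
  filter_upwards [prod_mem_nhds (ball_mem_nhds y₀ hρ) (ball_mem_nhds y₀ hρ)] with ⟨y, z⟩ ⟨hy, hz⟩
  dsimp only at hy hz ⊢
  set w := z - y with hw
  let f : ℝ → ℝ := fun s => g (y + s • w) - s * inner ℝ w (∇ g y) - s ^ 2 / 2 * inner ℝ (A w) w
  have hline : ∀ s : ℝ, HasDerivAt (fun s : ℝ => y + s • w) w s := fun s => by
    simpa using ((hasDerivAt_id s).smul_const w).const_add y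
  have hf : ∀ s : ℝ, HasDerivAt f (inner ℝ (∇ g (y + s • w) - ∇ g y - A (s • w)) w) s := by
    intro s
    have h1 := (hasFDerivAt_innerSL_gradient hg (y + s • w)).comp_hasDerivAt s (hline s)
    have h2 := (hasDerivAt_id s).mul_const (inner ℝ w (∇ g y))
    have h3 := (((hasDerivAt_id s).pow 2).div_const 2).mul_const (inner ℝ (A w) w)
    refine ((h1.sub h2).sub h3).congr_deriv ?_
    simp only [map_smul, innerSL_apply_apply, id]
    rw [inner_sub_left _ _ w, inner_sub_left _ _ w, real_inner_smul_left, real_inner_comm (∇ g y) w]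
    push_cast
    ring
  have hb : ∀ s ∈ Icc (0 : ℝ) 1,
      ‖inner ℝ (∇ g (y + s • w) - ∇ g y - A (s • w)) w‖ ≤ ε * ‖w‖ ^ 2 := by
    intro s hs
    have hmem : y + s • w ∈ ball y₀ ρ := (convex_ball y₀ ρ).add_smul_sub_mem hy hz hs
    have h1 := hsub' y hy _ hmem
    rw [add_sub_cancel_left] at h1
    have h2 : ‖s • w‖ ≤ ‖w‖ := by
      rw [norm_smul, Real.norm_of_nonneg hs.1]
      exact mul_le_of_le_one_left (norm_nonneg _) hs.2
    calc _ ≤ ‖∇ g (y + s • w) - ∇ g y - A (s • w)‖ * ‖w‖ := norm_inner_le_norm _ _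
      _ ≤ (ε * ‖w‖) * ‖w‖ := by gcongr; exact h1.trans (by gcongr)
      _ = ε * ‖w‖ ^ 2 := by ring
  have := (convex_Icc (0 : ℝ) 1).norm_image_sub_le_of_norm_hasDerivWithin_le
    (fun s _ => (hf s).hasDerivWithinAt) hb (left_mem_Icc.2 zero_le_one)
    (right_mem_Icc.2 zero_le_one)
  have hyw : y + w = z := by simp [hw]
  have hdiff : f 1 - f 0 =
      g z - g y - inner ℝ w (∇ g y) - 1 / 2 * inner ℝ (A w) w := by
    simp only [f, one_smul, zero_smul, add_zero, hyw]
    ring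
  rwa [hdiff, Real.norm_eq_abs, sub_zero, norm_one, mul_one] at this

theorem exists_strictCharMin (hg : ContDiff ℝ 2 g) {y : EuclideanSpace ℝ (Fin n)}
    (hy : ∇ g y ≠ 0) : ∃ t, 0 < t ∧ StrictCharMin g y t := by
  have hp : 0 < ‖∇ g y‖ := norm_pos_iff.2 hy
  have hT : ∀ᶠ z in 𝓝 y, _ :=
    ((Continuous.prodMk_right y).tendsto y).eventually (eventually_taylor hg y one_pos)
  obtain ⟨ρ, hρ, hsub⟩ := Metric.eventually_nhds_iff_ball.1 hT
  set A := fderiv ℝ (∇ g) y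
  have hA : 0 < ‖A‖ + 3 := by positivity
  refine ⟨min (ρ / 3) (‖∇ g y‖ / (‖A‖ + 3)), by positivity, fun z hz hne => ?_⟩
  set t := min (ρ / 3) (‖∇ g y‖ / (‖A‖ + 3)) with ht
  have ht0 : 0 < t := by positivity
  have ht1 : t ≤ ρ / 3 := min_le_left _ _
  have ht2 : t * (‖A‖ + 3) ≤ ‖∇ g y‖ := (le_div_iff₀ hA).1 (min_le_right _ _)
  have hzρ : z ∈ ball y ρ := by
    have h1 := dist_triangle z (charPoint g y t) y
    have h2 := mem_closedBall.1 hz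
    have h3 := mem_closedBall'.1 (self_mem_closedBall_charPoint g y ht0.le)
    exact mem_ball.2 (by linarith)
  have h1 : |g z - g y - inner ℝ (z - y) (∇ g y) - 1 / 2 * inner ℝ (A (z - y)) (z - y)| ≤
      1 * ‖z - y‖ ^ 2 := hsub z hzρ
  have h2 := (mem_closedBall_charPoint_iff hy ht0.le).1 hz
  have h3 : |inner ℝ (A (z - y)) (z - y)| ≤ ‖A‖ * ‖z - y‖ ^ 2 := by
    refine (abs_real_inner_le_norm _ _).trans ?_
    rw [sq, ← mul_assoc]
    gcongr
    exact A.le_opNorm _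
  have h4 : 0 < ‖z - y‖ ^ 2 := pow_pos (norm_pos_iff.2 (sub_ne_zero.2 hne)) 2
  have h5 := (abs_le.1 h1).1
  have h6 := (abs_le.1 h3).1
  have h7 : t * ((‖A‖ + 3) * ‖z - y‖ ^ 2) ≤ t * (2 * inner ℝ (z - y) (∇ g y)) := by
    nlinarith [mul_le_mul_of_nonneg_right ht2 h4.le]
  have h8 := le_of_mul_le_mul_left h7 ht0
  nlinarith

theorem firstTime_pos (hg : ContDiff ℝ 2 g) {y : EuclideanSpace ℝ (Fin n)} (hy : ∇ g y ≠ 0) :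
    0 < firstTime g y := by
  obtain ⟨t, ht, h⟩ := exists_strictCharMin hg hy
  exact (ENNReal.ofReal_pos.2 ht).trans_le (h.le_firstTime hg.continuous ht)

/-- If `y` minimizes `g` in its touching ball of radius `t`, then the Hessian at `y` in directions
tangent to the level set is bounded below in terms of the curvature of any smaller ball. -/
theorem CharMin.inner_hessian_ge (hg : ContDiff ℝ 2 g) {y : EuclideanSpace ℝ (Fin n)}
    (hy : ∇ g y ≠ 0) {s t : ℝ} (hs : 0 < s) (hst : s < t) (h : CharMin g y t)
    {τ : EuclideanSpace ℝ (Fin n)} (hτ : inner ℝ τ (∇ g y) = 0) :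
    -(‖∇ g y‖ / s) * ‖τ‖ ^ 2 ≤ inner ℝ (fderiv ℝ (∇ g) y τ) τ := by
  have hp : 0 < ‖∇ g y‖ := norm_pos_iff.2 hy
  rcases eq_or_ne τ 0 with rfl | hτ0
  · simp
  have hτn : 0 < ‖τ‖ ^ 2 := pow_pos (norm_pos_iff.2 hτ0) 2
  set A := fderiv ℝ (∇ g) y
  -- The curve `y + r • v r` has normal part quadratic in `r`; it stays in the ball of radius `t`
  -- because its curvature is that of the ball of radius `s`.
  let v : ℝ → EuclideanSpace ℝ (Fin n) := fun r => τ + (r * (‖τ‖ ^ 2 / (2 * s) / ‖∇ g y‖)) • ∇ g y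
  have hv : Continuous v := by fun_prop
  have hv0 : v 0 = τ := by simp [v]
  have hinner : ∀ r, inner ℝ (v r) (∇ g y) = r * (‖τ‖ ^ 2 / (2 * s)) * ‖∇ g y‖ := fun r => by
    simp only [v, inner_add_left, hτ, real_inner_smul_left, real_inner_self_eq_norm_sq]
    field_simp
    simp
  have key : ∀ ε > 0,
      0 ≤ ‖∇ g y‖ * (‖τ‖ ^ 2 / (2 * s)) + 1 / 2 * inner ℝ (A τ) τ + ε * ‖τ‖ ^ 2 := by
    intro ε hε
    have hT : ∀ᶠ z in 𝓝 y, _ :=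
      ((Continuous.prodMk_right y).tendsto y).eventually (eventually_taylor hg y hε)
    have hcurve : Tendsto (fun r => y + r • v r) (𝓝 0) (𝓝 y) := by
      have : Continuous fun r : ℝ => y + r • v r := by fun_prop
      simpa using this.tendsto 0
    have hball : ∀ᶠ r in 𝓝 (0 : ℝ), ‖∇ g y‖ * ‖v r‖ ^ 2 <
        2 * t * ((‖τ‖ ^ 2 / (2 * s)) * ‖∇ g y‖) := by
      have hc : Continuous fun r : ℝ => ‖∇ g y‖ * ‖v r‖ ^ 2 := by fun_prop
      refine hc.continuousAt.eventually (gt_mem_nhds ?_)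
      simp only [hv0]
      have : 2 * t * ((‖τ‖ ^ 2 / (2 * s)) * ‖∇ g y‖) = ‖∇ g y‖ * ‖τ‖ ^ 2 * (t / s) := by
        field_simp
      rw [this]
      exact lt_mul_of_one_lt_right (by positivity) ((one_lt_div hs).2 hst)
    have hlim : Tendsto (fun r => ‖∇ g y‖ * (‖τ‖ ^ 2 / (2 * s)) + 1 / 2 * inner ℝ (A (v r)) (v r)
        + ε * ‖v r‖ ^ 2) (𝓝[≠] 0)
        (𝓝 (‖∇ g y‖ * (‖τ‖ ^ 2 / (2 * s)) + 1 / 2 * inner ℝ (A τ) τ + ε * ‖τ‖ ^ 2)) := by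
      have hc : Continuous fun r => ‖∇ g y‖ * (‖τ‖ ^ 2 / (2 * s)) +
        1 / 2 * inner ℝ (A (v r)) (v r) + ε * ‖v r‖ ^ 2 := by fun_prop
      have := hc.tendsto 0
      rw [hv0] at this
      exact this.mono_left nhdsWithin_le_nhds
    refine ge_of_tendsto hlim ?_
    filter_upwards [eventually_nhdsWithin_of_eventually_nhds (hcurve.eventually hT),
      eventually_nhdsWithin_of_eventually_nhds hball, self_mem_nhdsWithin] with r h1 h2 hr
    have hr0 : r ≠ 0 := hr
    have hr2 : 0 < r ^ 2 := by positivity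
    have hmem : y + r • v r ∈ closedBall (charPoint g y t) t := by
      rw [mem_closedBall_charPoint_iff hy (hs.trans hst).le, add_sub_cancel_left, norm_smul,
        real_inner_smul_left, hinner, mul_pow, Real.norm_eq_abs, sq_abs]
      nlinarith [mul_le_mul_of_nonneg_left h2.le hr2.le]
    have h3 := h _ hmem
    have h4 := (abs_le.1 h1).2
    simp only [add_sub_cancel_left, real_inner_smul_left, hinner, map_smul, real_inner_smul_right,
      norm_smul, mul_pow, Real.norm_eq_abs, sq_abs] at h4
    have h5 : 0 ≤ r ^ 2 * (‖∇ g y‖ * (‖τ‖ ^ 2 / (2 * s)) + 1 / 2 * inner ℝ (A (v r)) (v r)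
        + ε * ‖v r‖ ^ 2) := by
      have : (fderiv ℝ (∇ g) y) = A := rfl
      rw [this] at h4
      nlinarith
    exact nonneg_of_mul_nonneg_right h5 hr2
  by_contra hcon
  have hcon' := not_le.1 hcon
  set d := -(‖∇ g y‖ / s) * ‖τ‖ ^ 2 - inner ℝ (A τ) τ with hd
  have hd0 : 0 < d := sub_pos.2 hcon'
  have h1 := key (d / 4 / ‖τ‖ ^ 2) (by positivity)
  rw [div_mul_cancel₀ _ hτn.ne'] at h1
  have h2 : ‖∇ g y‖ * (‖τ‖ ^ 2 / (2 * s)) = (‖∇ g y‖ / s) * ‖τ‖ ^ 2 / 2 := by field_simp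
  rw [h2] at h1
  linarith

/-- Local uniqueness, uniform in the base point: the Hessian bound at `y₀` that comes with a larger
touching ball makes the points near `y₀` strict local minimizers in the smaller touching balls. -/
theorem CharMin.eventually_lt (hg : ContDiff ℝ 2 g) {y₀ : EuclideanSpace ℝ (Fin n)}
    (hy₀ : ∇ g y₀ ≠ 0) {t t' : ℝ} (ht : 0 < t) (htt : t < t') (h : CharMin g y₀ t') :
    ∀ᶠ q : EuclideanSpace ℝ (Fin n) × EuclideanSpace ℝ (Fin n) in 𝓝 (y₀, y₀),
      q.2 ∈ closedBall (charPoint g q.1 t) t → q.2 ≠ q.1 → g q.1 < g q.2 := by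
  obtain ⟨s, hts, hst⟩ := exists_between htt
  have hs : 0 < s := ht.trans hts
  set P := ‖∇ g y₀‖ with hP
  have hP0 : 0 < P := norm_pos_iff.2 hy₀
  set A := fderiv ℝ (∇ g) y₀ with hA
  set κ := (P / (2 * t) - P / (2 * s)) / 2 with hκ
  have hκ0 : 0 < κ := by
    refine half_pos (sub_pos.2 ?_)
    gcongr
  obtain ⟨η, hη, hηκ⟩ := exists_pos_mul_lt hκ0 (1 / (2 * t) + 2 * ‖A‖ / P)
  obtain ⟨ρ, hρ, hρη⟩ := exists_pos_mul_lt hη (‖A‖ / 2 + κ)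
  have hgrad : ∀ᶠ q : EuclideanSpace ℝ (Fin n) × EuclideanSpace ℝ (Fin n) in 𝓝 (y₀, y₀),
      ‖∇ g q.1 - ∇ g y₀‖ < η := by
    have hc : Continuous fun q : EuclideanSpace ℝ (Fin n) × EuclideanSpace ℝ (Fin n) =>
      ‖∇ g q.1 - ∇ g y₀‖ := (((continuous_gradient hg).comp continuous_fst).sub
        continuous_const).norm
    exact hc.continuousAt.eventually (gt_mem_nhds (by simpa using hη))
  have hne : ∀ᶠ q : EuclideanSpace ℝ (Fin n) × EuclideanSpace ℝ (Fin n) in 𝓝 (y₀, y₀),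
      ∇ g q.1 ≠ 0 :=
    ((continuous_gradient hg).comp continuous_fst).continuousAt.eventually_ne hy₀
  have hnear : ∀ᶠ q : EuclideanSpace ℝ (Fin n) × EuclideanSpace ℝ (Fin n) in 𝓝 (y₀, y₀),
      ‖q.2 - q.1‖ < ρ := by
    have hc : Continuous fun q : EuclideanSpace ℝ (Fin n) × EuclideanSpace ℝ (Fin n) =>
      ‖q.2 - q.1‖ := by fun_prop
    exact hc.continuousAt.eventually (gt_mem_nhds (by simpa using hρ))
  filter_upwards [eventually_taylor hg y₀ hκ0, hgrad, hne, hnear] with ⟨y, z⟩ hT hgy hy hzρ hz hzy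
  dsimp only at hT hgy hy hzρ hz hzy ⊢
  set w := z - y with hw
  have hw0 : 0 < ‖w‖ := norm_pos_iff.2 (sub_ne_zero.2 hzy)
  have hball := (mem_closedBall_charPoint_iff hy ht.le).1 hz
  set c : ℝ := inner ℝ w (∇ g y) with hc
  have hT' := (abs_le.1 hT).1
  have hAw : ∀ u u' : EuclideanSpace ℝ (Fin n), |inner ℝ (A u) u'| ≤ ‖A‖ * ‖u‖ * ‖u'‖ :=
    fun u u' => (abs_real_inner_le_norm _ _).trans (by gcongr; exact A.le_opNorm _)
  suffices hmain : 0 < c + 1 / 2 * inner ℝ (A w) w - κ * ‖w‖ ^ 2 by linarith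
  rcases le_or_gt (η * ‖w‖) c with hcase | hcase
  · -- Directions with a normal part: the first-order term wins.
    have h1 := (abs_le.1 (hAw w w)).1
    have h2 : (‖A‖ / 2 + κ) * ‖w‖ < η := (by gcongr : (‖A‖ / 2 + κ) * ‖w‖ ≤ _).trans_lt hρη
    nlinarith [mul_lt_mul_of_pos_right h2 hw0]
  · -- Almost tangent directions: compare with the tangential part `τ` of `w` at `y₀`.
    have hc0 : 0 ≤ c := by
      have : 0 ≤ ‖∇ g y‖ * ‖w‖ ^ 2 := by positivity
      exact nonneg_of_mul_nonneg_right (this.trans hball) (by linarith)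
    set c₀ : ℝ := inner ℝ w (∇ g y₀) with hc₀
    have hcc : |c - c₀| ≤ η * ‖w‖ := by
      rw [hc, hc₀, ← inner_sub_right, mul_comm]
      exact (abs_real_inner_le_norm _ _).trans (by gcongr)
    have hc₀abs : |c₀| ≤ 2 * η * ‖w‖ := by
      rw [abs_le] at hcc ⊢
      constructor <;> linarith [hcc.1, hcc.2]
    set r := (c₀ / P ^ 2) • ∇ g y₀ with hr
    have hrn : ‖r‖ * P ≤ 2 * η * ‖w‖ := by
      have : ‖r‖ * P = |c₀| := by
        rw [hr, norm_smul, ← hP, norm_div, norm_pow, Real.norm_eq_abs, Real.norm_of_nonneg hP0.le]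
        field_simp
      rwa [this]
    set τ := w - r with hτdef
    have hτ : inner ℝ τ (∇ g y₀) = 0 := by
      rw [hτdef, hr, inner_sub_left, real_inner_smul_left, real_inner_self_eq_norm_sq, ← hP, ← hc₀,
        div_mul_cancel₀ _ (by positivity), sub_self]
    have hwτ : w = τ + r := by simp [hτdef]
    have hτr : inner ℝ τ r = 0 := by rw [hr, real_inner_smul_right, hτ, mul_zero]
    have hτw : ‖τ‖ ^ 2 ≤ ‖w‖ ^ 2 := by
      rw [hwτ, norm_add_sq_real, hτr]; nlinarith [sq_nonneg ‖r‖]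
    have hτw' : ‖τ‖ ≤ ‖w‖ := (sq_le_sq₀ (norm_nonneg _) (norm_nonneg _)).1 hτw
    have h1 := h.inner_hessian_ge hg hy₀ hs hst hτ
    have h2 : inner ℝ (A w) w = inner ℝ (A τ) τ + inner ℝ (A τ) r + inner ℝ (A r) w := by
      have : A w = A τ + A r := by rw [hwτ, map_add]
      rw [this, inner_add_left, ← inner_add_right, ← hwτ]
    have h3 := (abs_le.1 ((hAw τ r).trans
      (by gcongr : ‖A‖ * ‖τ‖ * ‖r‖ ≤ ‖A‖ * ‖w‖ * ‖r‖))).1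
    have h4 := (abs_le.1 (hAw r w)).1
    have h5 : ‖r‖ ≤ 2 * η / P * ‖w‖ := by
      rw [div_mul_eq_mul_div, le_div_iff₀ hP0]; exact hrn
    have h6 : ‖A‖ * ‖w‖ * ‖r‖ ≤ ‖A‖ * ‖w‖ * (2 * η / P * ‖w‖) := by gcongr
    have h7 : P - η ≤ ‖∇ g y‖ := by
      have := norm_sub_norm_le (∇ g y₀) (∇ g y)
      rw [norm_sub_rev] at this
      linarith
    have h8 : (P - η) / (2 * t) * ‖w‖ ^ 2 ≤ c := by
      rw [div_mul_eq_mul_div, div_le_iff₀ (by positivity)]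
      linarith [mul_le_mul_of_nonneg_right h7 (sq_nonneg ‖w‖)]
    have h9 : P / s * ‖τ‖ ^ 2 ≤ P / s * ‖w‖ ^ 2 := by gcongr
    have h10 : (P - η) / (2 * t) * ‖w‖ ^ 2 - 1 / 2 * (P / s * ‖w‖ ^ 2)
        - ‖A‖ * ‖w‖ * (2 * η / P * ‖w‖) =
        (2 * κ - (1 / (2 * t) + 2 * ‖A‖ / P) * η) * ‖w‖ ^ 2 := by
      rw [hκ]; field_simp; ring
    have h11 : κ * ‖w‖ ^ 2 < (2 * κ - (1 / (2 * t) + 2 * ‖A‖ / P) * η) * ‖w‖ ^ 2 := by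
      gcongr; linarith
    rw [h2]
    rw [← hP, ← hA] at h1
    rw [mul_right_comm] at h4
    linarith

/-! ### Semicontinuity of the termination times -/

theorem continuousAt_charPoint (hg : ContDiff ℝ 2 g) {y₀ : EuclideanSpace ℝ (Fin n)}
    (hy₀ : ∇ g y₀ ≠ 0) (t : ℝ) : ContinuousAt (fun y => charPoint g y t) y₀ := by
  have hc := (continuous_gradient hg).continuousAt (x := y₀)
  exact continuousAt_id.add
    (((hc.norm.inv₀ (norm_ne_zero_iff.2 hy₀)).smul hc).const_smul t)

/-- Points near `y₀` that lie on a lower level than `y₀`, or all points near `y₀` if the larger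
ball has no second minimizer, are unique minimizers in the smaller touching balls. -/
theorem CharMin.eventually_strictCharMin (hg : ContDiff ℝ 2 g) {y₀ : EuclideanSpace ℝ (Fin n)}
    (hy₀ : ∇ g y₀ ≠ 0) {t t' : ℝ} (ht : 0 < t) (htt : t < t') (h : CharMin g y₀ t') :
    ∀ᶠ y in 𝓝 y₀, (g y < g y₀ ∨ StrictCharMin g y₀ t') → StrictCharMin g y t := by
  have hK := (isCompact_closedBall (0 : EuclideanSpace ℝ (Fin n))
    1).eventually_forall_of_forall_eventually (x₀ := y₀)
    (P := fun y e => ‖e‖ ≤ 1 → (g y < g y₀ ∨ StrictCharMin g y₀ t') →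
      charPoint g y t + t • e ≠ y → g y < g (charPoint g y t + t • e)) ?_
  · filter_upwards [hK] with y hy hor z hz hne
    have he : ‖t⁻¹ • (z - charPoint g y t)‖ ≤ 1 := by
      rw [norm_smul, norm_inv, Real.norm_of_nonneg ht.le, inv_mul_le_one₀ ht]
      exact mem_closedBall_iff_norm.1 hz
    have hze : charPoint g y t + t • (t⁻¹ • (z - charPoint g y t)) = z := by
      rw [smul_inv_smul₀ ht.ne', add_sub_cancel]
    have := hy _ (mem_closedBall_zero_iff.2 he) he hor
    rw [hze] at this
    exact this hne
  · intro e he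
    have he' : ‖e‖ ≤ 1 := mem_closedBall_zero_iff.1 he
    set z₀ := charPoint g y₀ t + t • e with hz₀
    have hball : ∀ (y u : EuclideanSpace ℝ (Fin n)), ‖u‖ ≤ 1 →
        charPoint g y t + t • u ∈ closedBall (charPoint g y t) t := by
      intro y u hu
      rw [mem_closedBall_iff_norm, add_sub_cancel_left, norm_smul, Real.norm_of_nonneg ht.le]
      exact mul_le_of_le_one_right ht.le hu
    have hz : Tendsto (fun q : EuclideanSpace ℝ (Fin n) × EuclideanSpace ℝ (Fin n) =>
        charPoint g q.1 t + t • q.2) (𝓝 (y₀, e)) (𝓝 z₀) :=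
      ((continuousAt_charPoint hg hy₀ t).tendsto.comp (continuousAt_fst (p := (y₀, e)))).add
        (tendsto_const_nhds.smul (continuousAt_snd (p := (y₀, e))))
    have hfst : Tendsto (fun q : EuclideanSpace ℝ (Fin n) × EuclideanSpace ℝ (Fin n) => q.1)
      (𝓝 (y₀, e)) (𝓝 y₀) := continuousAt_fst (p := (y₀, e))
    by_cases hzy : z₀ = y₀
    · rw [hzy] at hz
      filter_upwards [(hfst.prodMk_nhds hz).eventually (h.eventually_lt hg hy₀ ht htt)]
        with q hq hu _ hne
      exact hq (hball q.1 q.2 hu) hne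
    · have hzb : z₀ ∈ ball (charPoint g y₀ t') t' :=
        mem_ball_charPoint_of_lt hy₀ hzy ht.le htt (hball y₀ e he')
      by_cases hS : StrictCharMin g y₀ t'
      · have hlt : g y₀ < g z₀ := hS z₀ (ball_subset_closedBall hzb) hzy
        obtain ⟨m, hm1, hm2⟩ := exists_between hlt
        filter_upwards [hfst.eventually (hg.continuous.continuousAt.eventually (gt_mem_nhds hm1)),
          hz.eventually (hg.continuous.continuousAt.eventually (lt_mem_nhds hm2))]
          with q h1 h2 _ _ _
        exact h1.trans h2
      · filter_upwards [hz.eventually (isOpen_ball.mem_nhds hzb)] with q hq _ hor _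
        exact (hor.resolve_right hS).trans_le (h _ (ball_subset_closedBall hq))

theorem eventually_not_charMin (hg : ContDiff ℝ 2 g) {y₀ : EuclideanSpace ℝ (Fin n)}
    (hy₀ : ∇ g y₀ ≠ 0) {t : ℝ} (h : ¬ CharMin g y₀ t) :
    ∀ᶠ y in 𝓝 y₀, ¬ CharMin g y t := by
  simp only [CharMin, not_forall, not_le] at h
  obtain ⟨z, hz, hlt⟩ := h
  obtain ⟨u, hu⟩ : ∃ u, z = charPoint g y₀ t + u := ⟨z - charPoint g y₀ t, by simp⟩
  rw [hu, mem_closedBall_iff_norm, add_sub_cancel_left] at hz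
  have hc : ContinuousAt (fun y => g (charPoint g y t + u)) y₀ :=
    hg.continuous.continuousAt.comp ((continuousAt_charPoint hg hy₀ t).add continuousAt_const)
  filter_upwards [hc.eventually_lt hg.continuous.continuousAt (by rwa [← hu])] with y hy hmin
  refine hy.not_ge (hmin _ ?_)
  rwa [mem_closedBall_iff_norm, add_sub_cancel_left]

/-- Points near `y₀` on a higher level than `y₀` stop being minimizers soon after `y₀` has stopped
being the unique one: a second point of the closed ball is interior to the slightly larger one. -/
theorem eventually_not_charMin_of_not_strictCharMin (hg : ContDiff ℝ 2 g)
    {y₀ : EuclideanSpace ℝ (Fin n)} (hy₀ : ∇ g y₀ ≠ 0) {s t : ℝ} (hs : 0 < s) (hst : s < t)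
    (h : ¬ StrictCharMin g y₀ s) : ∀ᶠ y in 𝓝 y₀, g y₀ < g y → ¬ CharMin g y t := by
  simp only [StrictCharMin, not_forall, not_lt] at h
  obtain ⟨z, hz, hne, hle⟩ := h
  have hzb := mem_ball_charPoint_of_lt hy₀ hne hs.le hst hz
  have hc : ContinuousAt (fun y => dist z (charPoint g y t)) y₀ :=
    continuousAt_const.dist (continuousAt_charPoint hg hy₀ t)
  filter_upwards [hc.eventually (gt_mem_nhds (mem_ball.1 hzb))] with y hy hlt hmin
  exact (hle.trans_lt hlt).not_ge (hmin z (mem_closedBall.2 (le_of_lt hy)))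

/-! ### Differentiability of the Hopf-Lax solution -/

/-- First-order condition: a minimizer that is not a critical point lies on the sphere, and its
characteristic passes through the centre of the ball. -/
theorem eq_charPoint_of_mem_minimizers (hg : ContDiff ℝ 2 g) {x y : EuclideanSpace ℝ (Fin n)}
    {t : ℝ} (ht : 0 ≤ t) (hy : y ∈ minimizers g x t) (hy0 : ∇ g y ≠ 0) :
    x = charPoint g y t := by
  obtain ⟨hyx, hmin⟩ := (mem_minimizers_iff hg.continuous ht).1 hy
  have hp : 0 < ‖∇ g y‖ := norm_pos_iff.2 hy0
  have hw : x - (t * ‖∇ g y‖⁻¹) • ∇ g y ∈ closedBall x t := by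
    rw [mem_closedBall_iff_norm, sub_sub_cancel_left, norm_neg, norm_smul, norm_mul, norm_inv,
      norm_norm, Real.norm_of_nonneg ht, mul_assoc, inv_mul_cancel₀ hp.ne', mul_one]
  have hloc : IsLocalMinOn g (closedBall x t) y := (isMinOn_iff.2 hmin).localize
  have h := hloc.hasFDerivWithinAt_nonneg (hasFDerivAt_innerSL_gradient hg y).hasFDerivWithinAt
    (sub_mem_posTangentConeAt_of_segment_subset ((convex_closedBall x t).segment_subset hyx hw))
  rw [innerSL_apply_apply, inner_sub_right, inner_sub_right, real_inner_smul_right,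
    real_inner_self_eq_norm_sq] at h
  have h1 : t * ‖∇ g y‖⁻¹ * ‖∇ g y‖ ^ 2 = t * ‖∇ g y‖ := by field_simp
  have h2 : ‖x - charPoint g y t‖ ^ 2 * ‖∇ g y‖ ≤ 0 := by
    rw [mul_comm, norm_sub_charPoint_sq hy0, inner_sub_left, real_inner_comm (∇ g y) x,
      real_inner_comm (∇ g y) y]
    have h3 : ‖x - y‖ ^ 2 ≤ t ^ 2 := by
      rw [mem_closedBall_iff_norm'] at hyx
      gcongr
    nlinarith
  have h4 : ‖x - charPoint g y t‖ ^ 2 ≤ 0 := nonpos_of_mul_nonpos_left h2 hp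
  have h5 : ‖x - charPoint g y t‖ = 0 := by
    have := sq_nonneg ‖x - charPoint g y t‖
    exact pow_eq_zero_iff two_ne_zero |>.1 (le_antisymm h4 this)
  exact sub_eq_zero.1 (norm_eq_zero.1 h5)

theorem eq_of_gradient_eq (hg : ContDiff ℝ 2 g) {x y y' : EuclideanSpace ℝ (Fin n)}
    {t : ℝ} (ht : 0 ≤ t) (hy : y ∈ minimizers g x t) (hy' : y' ∈ minimizers g x t)
    (hy0 : ∇ g y ≠ 0) (h : ∇ g y' = ∇ g y) : y' = y := by
  have h1 := eq_charPoint_of_mem_minimizers hg ht hy hy0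
  have h2 := eq_charPoint_of_mem_minimizers hg ht hy' (h ▸ hy0)
  rw [h1, charPoint, charPoint, h] at h2
  exact (add_right_cancel h2).symm

theorem hopfLax_le (hg : Continuous g) {q : EuclideanSpace ℝ (Fin n) × ℝ} (hq : 0 ≤ q.2)
    {e : EuclideanSpace ℝ (Fin n)} (he : ‖e‖ ≤ 1) : hopfLax g q.1 q.2 ≤ g (q.1 + q.2 • e) := by
  refine (hopfLax_isLeast hg q.1 hq).2 (mem_image_of_mem g ?_)
  rw [mem_closedBall_iff_norm, add_sub_cancel_left, norm_smul, Real.norm_of_nonneg hq]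
  exact mul_le_of_le_one_right hq he

/-- A minimizer in polar form about the centre of the ball. -/
theorem exists_direction {x y : EuclideanSpace ℝ (Fin n)} {t : ℝ} (ht : 0 < t)
    (hy : y ∈ minimizers g x t) :
    ∃ e : EuclideanSpace ℝ (Fin n), ‖e‖ ≤ 1 ∧ y = x + t • e ∧ hopfLax g x t = g (x + t • e) := by
  have h : x + t • (t⁻¹ • (y - x)) = y := by rw [smul_inv_smul₀ ht.ne', add_sub_cancel]
  refine ⟨t⁻¹ • (y - x), ?_, h.symm, by rw [h]; exact hy.2⟩
  rw [norm_smul, norm_inv, Real.norm_of_nonneg ht.le, inv_mul_le_one₀ ht]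
  exact mem_closedBall_iff_norm.1 hy.1

/-- The derivative of `(x, t) ↦ g (x + t • e)` if `p` is the gradient of `g` at `x + t • e`. -/
noncomputable def directionFDeriv {n : ℕ} (p e : EuclideanSpace ℝ (Fin n)) :
    EuclideanSpace ℝ (Fin n) × ℝ →L[ℝ] ℝ :=
  (innerSL ℝ p).coprod (ContinuousLinearMap.toSpanSingleton ℝ (inner ℝ p e))

theorem directionFDeriv_apply (p e : EuclideanSpace ℝ (Fin n))
    (v : EuclideanSpace ℝ (Fin n) × ℝ) :
    directionFDeriv p e v = inner ℝ p v.1 + v.2 * inner ℝ p e := by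
  simp [directionFDeriv]

theorem hasFDerivAt_direction (hg : ContDiff ℝ 2 g) (e : EuclideanSpace ℝ (Fin n))
    (q : EuclideanSpace ℝ (Fin n) × ℝ) :
    HasFDerivAt (fun q : EuclideanSpace ℝ (Fin n) × ℝ => g (q.1 + q.2 • e))
      (directionFDeriv (∇ g (q.1 + q.2 • e)) e) q := by
  have h1 : HasFDerivAt (fun q : EuclideanSpace ℝ (Fin n) × ℝ => q.1 + q.2 • e)
      (ContinuousLinearMap.fst ℝ _ ℝ + (ContinuousLinearMap.snd ℝ _ ℝ).smulRight e) q :=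
    hasFDerivAt_fst.add (hasFDerivAt_snd.smul_const e)
  refine ((hasFDerivAt_innerSL_gradient hg _).comp q h1).congr_fderiv ?_
  refine ContinuousLinearMap.ext fun v => ?_
  rw [directionFDeriv_apply]
  simp only [ContinuousLinearMap.comp_apply, add_apply,
    ContinuousLinearMap.smulRight_apply, ContinuousLinearMap.coe_fst', ContinuousLinearMap.coe_snd',
    innerSL_apply_apply, inner_add_right, real_inner_smul_right]

/-- At a point of differentiability, the derivative of the solution is determined by any
minimizer. -/
theorem fderiv_hopfLax_eq (hg : ContDiff ℝ 2 g) {x : EuclideanSpace ℝ (Fin n)} {t : ℝ}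
    (ht : 0 < t)
    {L : EuclideanSpace ℝ (Fin n) × ℝ →L[ℝ] ℝ}
    (hL : HasFDerivAt (fun q : EuclideanSpace ℝ (Fin n) × ℝ => hopfLax g q.1 q.2) L (x, t))
    {y : EuclideanSpace ℝ (Fin n)} (hy : y ∈ minimizers g x t)
    (v : EuclideanSpace ℝ (Fin n)) : L (v, 0) = inner ℝ (∇ g y) v := by
  obtain ⟨e, he, hye, hu⟩ := exists_direction ht hy
  have hmin : IsLocalMin (fun q : EuclideanSpace ℝ (Fin n) × ℝ =>
      g (q.1 + q.2 • e) - hopfLax g q.1 q.2) (x, t) := by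
    have hpos : ∀ᶠ q : EuclideanSpace ℝ (Fin n) × ℝ in 𝓝 (x, t), 0 < q.2 :=
      continuousAt_snd.eventually (lt_mem_nhds ht)
    filter_upwards [hpos] with q hq
    have := hopfLax_le hg.continuous hq.le he
    simp only [hu, sub_self]
    linarith
  have h := hmin.hasFDerivAt_eq_zero ((hasFDerivAt_direction hg e (x, t)).sub hL)
  have h' := congrArg (fun T : EuclideanSpace ℝ (Fin n) × ℝ →L[ℝ] ℝ => T (v, 0)) h
  simp only [sub_apply, directionFDeriv_apply, ← hye,
    zero_apply, zero_mul, add_zero] at h'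
  exact (sub_eq_zero.1 h').symm

/-- If all minimizers have the same gradient, the solution is differentiable: by compactness, the
derivatives of the functions `g (x + t • e)` at minimizing directions `e` of nearby points are close
to their common value at the given point. -/
theorem differentiableAt_hopfLax (hg : ContDiff ℝ 2 g) {x : EuclideanSpace ℝ (Fin n)} {t : ℝ}
    (ht : 0 < t) {p : EuclideanSpace ℝ (Fin n)} (h : ∀ y ∈ minimizers g x t, ∇ g y = p) :
    DifferentiableAt ℝ (fun q : EuclideanSpace ℝ (Fin n) × ℝ => hopfLax g q.1 q.2) (x, t) := by
  let L : EuclideanSpace ℝ (Fin n) × ℝ →L[ℝ] ℝ :=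
    (innerSL ℝ p).coprod (ContinuousLinearMap.toSpanSingleton ℝ (-‖p‖))
  have hLapp : ∀ v, L v = inner ℝ p v.1 + v.2 * (-‖p‖) := fun v => by simp [L]
  have hdir : ∀ e : EuclideanSpace ℝ (Fin n), x + t • e ∈ minimizers g x t →
      inner ℝ p e = -‖p‖ := by
    intro e he
    rcases eq_or_ne p 0 with rfl | hp
    · simp
    · have h1 := eq_charPoint_of_mem_minimizers hg ht.le he (by rwa [h _ he])
      rw [charPoint, h _ he, add_assoc, left_eq_add, ← smul_add, smul_eq_zero] at h1
      have h2 : e = -(‖p‖⁻¹ • p) := eq_neg_of_add_eq_zero_left (h1.resolve_left ht.ne')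
      rw [h2, inner_neg_right, real_inner_smul_right, real_inner_self_eq_norm_sq]
      have := norm_ne_zero_iff.2 hp
      field_simp
  let D : EuclideanSpace ℝ (Fin n) × ℝ → EuclideanSpace ℝ (Fin n) → ℝ := fun q e =>
    ‖∇ g (q.1 + q.2 • e) - p‖ + |inner ℝ (∇ g (q.1 + q.2 • e)) e + ‖p‖|
  have hD : ∀ q e, ‖directionFDeriv (∇ g (q.1 + q.2 • e)) e - L‖ ≤ D q e := by
    intro q e
    refine ContinuousLinearMap.opNorm_le_bound _ (by positivity) fun v => ?_
    have hv : (directionFDeriv (∇ g (q.1 + q.2 • e)) e - L) v =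
        inner ℝ (∇ g (q.1 + q.2 • e) - p) v.1 +
          (inner ℝ (∇ g (q.1 + q.2 • e)) e + ‖p‖) * v.2 := by
      rw [sub_apply, directionFDeriv_apply, hLapp, inner_sub_left]
      ring
    rw [hv, show D q e * ‖v‖ = _ from add_mul _ _ _]
    refine (norm_add_le _ _).trans (add_le_add ?_ ?_)
    · exact (norm_inner_le_norm _ _).trans (by gcongr; exact norm_fst_le v)
    · rw [norm_mul, Real.norm_eq_abs]
      gcongr
      exact norm_snd_le v
  have hgrad := continuous_gradient hg
  have hg' := hg.continuous
  refine HasFDerivAt.differentiableAt (f' := L) ?_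
  rw [hasFDerivAt_iff_isLittleO, Asymptotics.isLittleO_iff]
  intro ε hε
  have hK := (isCompact_closedBall (0 : EuclideanSpace ℝ (Fin n))
    1).eventually_forall_of_forall_eventually (x₀ := (((x, t), (x, t)) :
      (EuclideanSpace ℝ (Fin n) × ℝ) × (EuclideanSpace ℝ (Fin n) × ℝ)))
    (P := fun q e => (∀ e', ‖e'‖ ≤ 1 → g (q.1.1 + q.1.2 • e) ≤ g (q.1.1 + q.1.2 • e')) →
      D q.2 e < ε) ?_
  · rw [nhds_prod_eq, eventually_prod_self_iff'] at hK
    obtain ⟨V, hV, hVP⟩ := hK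
    obtain ⟨ρ, hρ, hsub⟩ := Metric.mem_nhds_iff.1 hV
    have hpos : ∀ᶠ q : EuclideanSpace ℝ (Fin n) × ℝ in 𝓝 (x, t), 0 < q.2 :=
      continuousAt_snd.eventually (lt_mem_nhds ht)
    filter_upwards [ball_mem_nhds _ hρ, hpos] with q hq hq0
    have hx : ((x, t) : EuclideanSpace ℝ (Fin n) × ℝ) ∈ ball (x, t) ρ := mem_ball_self hρ
    have hmv : ∀ q₁ ∈ ball ((x, t) : EuclideanSpace ℝ (Fin n) × ℝ) ρ,
        ∀ e : EuclideanSpace ℝ (Fin n), ‖e‖ ≤ 1 →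
        (∀ e', ‖e'‖ ≤ 1 → g (q₁.1 + q₁.2 • e) ≤ g (q₁.1 + q₁.2 • e')) →
        ‖g (q.1 + q.2 • e) - g (x + t • e) - L (q - (x, t))‖ ≤ ε * ‖q - (x, t)‖ := by
      intro q₁ hq₁ e he hemin
      exact (convex_ball _ ρ).norm_image_sub_le_of_norm_hasFDerivWithin_le'
        (f := fun q : EuclideanSpace ℝ (Fin n) × ℝ => g (q.1 + q.2 • e))
        (fun q' _ => (hasFDerivAt_direction hg e q').hasFDerivWithinAt)
        (fun q' hq' => (hD q' e).trans (hVP q₁ (hsub hq₁) q' (hsub hq') e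
          (mem_closedBall_zero_iff.2 he) hemin).le) hx hq
    obtain ⟨y₀, hy₀⟩ := nonempty_minimizers hg.continuous x ht.le
    obtain ⟨y₁, hy₁⟩ := nonempty_minimizers hg.continuous q.1 hq0.le
    obtain ⟨e₀, he₀, -, hu₀⟩ := exists_direction ht hy₀
    obtain ⟨e₁, he₁, -, hu₁⟩ := exists_direction hq0 hy₁
    have h0 := abs_le.1 (hmv _ hx e₀ he₀
      fun e' he' => hu₀ ▸ hopfLax_le hg.continuous (q := (x, t)) ht.le he')
    have h1 := abs_le.1 (hmv _ hq e₁ he₁ fun e' he' => hu₁ ▸ hopfLax_le hg.continuous hq0.le he')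
    have h2 := hopfLax_le hg.continuous hq0.le he₀
    have h3 := hopfLax_le hg.continuous (q := (x, t)) ht.le he₁
    dsimp only at h3 ⊢
    rw [Real.norm_eq_abs, abs_le]
    constructor <;> linarith [h0.1, h0.2, h1.1, h1.2]
  · intro e he
    have he' := mem_closedBall_zero_iff.1 he
    by_cases hmin : ∀ e', ‖e'‖ ≤ 1 → g (x + t • e) ≤ g (x + t • e')
    · have hmem : x + t • e ∈ minimizers g x t := by
        obtain ⟨y₀, hy₀⟩ := nonempty_minimizers hg.continuous x ht.le
        obtain ⟨e₀, he₀, -, hu₀⟩ := exists_direction ht hy₀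
        refine ⟨?_, le_antisymm (hopfLax_le hg.continuous (q := (x, t)) ht.le he')
          (hu₀ ▸ hmin e₀ he₀)⟩
        rw [mem_closedBall_iff_norm, add_sub_cancel_left, norm_smul, Real.norm_of_nonneg ht.le]
        exact mul_le_of_le_one_right ht.le he'
      have hD0 : D (x, t) e = 0 := by
        simp only [D, h _ hmem, hdir e hmem, sub_self, norm_zero, neg_add_cancel, abs_zero,
          add_zero]
      have hc : Continuous fun z : ((EuclideanSpace ℝ (Fin n) × ℝ) ×
          (EuclideanSpace ℝ (Fin n) × ℝ)) × EuclideanSpace ℝ (Fin n) => D z.1.2 z.2 := by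
        have h1 : Continuous fun z : ((EuclideanSpace ℝ (Fin n) × ℝ) ×
          (EuclideanSpace ℝ (Fin n) × ℝ)) × EuclideanSpace ℝ (Fin n) =>
            ∇ g (z.1.2.1 + z.1.2.2 • z.2) := hgrad.comp (by fun_prop)
        exact (h1.sub continuous_const).norm.add
          ((h1.inner continuous_snd).add continuous_const).abs
      have := hc.continuousAt (x := ((((x, t), (x, t)), e)))
      filter_upwards [this.eventually (gt_mem_nhds (show D (x, t) e < ε by rwa [hD0]))]
        with z hz _ using hz
    · push Not at hmin
      obtain ⟨e', he'1, hlt⟩ := hmin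
      have hc1 : Continuous fun z : ((EuclideanSpace ℝ (Fin n) × ℝ) ×
          (EuclideanSpace ℝ (Fin n) × ℝ)) × EuclideanSpace ℝ (Fin n) =>
          g (z.1.1.1 + z.1.1.2 • e') := hg'.comp (by fun_prop)
      have hc2 : Continuous fun z : ((EuclideanSpace ℝ (Fin n) × ℝ) ×
          (EuclideanSpace ℝ (Fin n) × ℝ)) × EuclideanSpace ℝ (Fin n) =>
          g (z.1.1.1 + z.1.1.2 • z.2) := hg'.comp (by fun_prop)
      filter_upwards [hc1.continuousAt.eventually_lt hc2.continuousAt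
        (show g (x + t • e') < g (x + t • e) from hlt)] with z hz hall
      exact absurd (hall e' he'1) hz.not_ge

/-- The solution fails to be differentiable exactly where two minimizers have different
gradients. -/
theorem mem_nondiffSet_iff (hg : ContDiff ℝ 2 g) {q : EuclideanSpace ℝ (Fin n) × ℝ} :
    q ∈ nondiffSet g ↔
      0 < q.2 ∧ ∃ y ∈ minimizers g q.1 q.2, ∃ y' ∈ minimizers g q.1 q.2, ∇ g y ≠ ∇ g y' := by
  refine and_congr_right fun hq => ⟨fun h => ?_, ?_⟩
  · by_contra! hall
    obtain ⟨y, hy⟩ := nonempty_minimizers hg.continuous q.1 hq.le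
    exact h (differentiableAt_hopfLax hg hq fun y' hy' => hall y' hy' y hy)
  · rintro ⟨y, hy, y', hy', hne⟩ hdiff
    refine hne (ext_inner_right ℝ fun v => ?_)
    rw [← fderiv_hopfLax_eq hg hq hdiff.hasFDerivAt hy,
      ← fderiv_hopfLax_eq hg hq hdiff.hasFDerivAt hy']

theorem nondiffSet_union_uniqueTerminationSet (hg : ContDiff ℝ 2 g) :
    nondiffSet g ∪ uniqueTerminationSet g = terminationPoints g (terminatingSet g) := by
  refine Subset.antisymm (union_subset ?_ fun q hq => hq.1) ?_
  · intro q hq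
    obtain ⟨hq0, y, hy, y', hy', hne⟩ := (mem_nondiffSet_iff hg).1 hq
    rw [mem_terminationPoints_iff hg.continuous fun y hy => hy.1]
    have main : ∀ y ∈ minimizers g q.1 q.2, ∀ y' ∈ minimizers g q.1 q.2, ∇ g y ≠ ∇ g y' →
        ∇ g y ≠ 0 → 0 < q.2 ∧ ∃ y ∈ terminatingSet g, q.1 = charPoint g y q.2 ∧
          firstTime g y ≤ ENNReal.ofReal q.2 ∧ CharMin g y q.2 := by
      intro y hy y' hy' hne hy0
      have hx := eq_charPoint_of_mem_minimizers hg hq0.le hy hy0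
      rw [hx] at hy hy'
      have hle : firstTime g y ≤ ENNReal.ofReal q.2 := by
        refine firstTime_le_of_not_strictCharMin hg.continuous fun hs => hne ?_
        rw [(minimizers_eq_singleton_iff hg.continuous hq0.le).2 hs] at hy'
        rw [mem_singleton_iff.1 hy']
      exact ⟨hq0, y, ⟨hy0, hle.trans_lt ENNReal.ofReal_lt_top⟩, hx, hle,
        (mem_minimizers_charPoint_iff hg.continuous hq0.le).1 hy⟩
    by_cases hy0 : ∇ g y = 0
    · exact main y' hy' y hy hne.symm fun h => hne (hy0.trans h.symm)
    · exact main y hy y' hy' hne hy0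
  · intro q hq
    obtain ⟨hq0, y, hyM, hx, -, hmin⟩ :=
      (mem_terminationPoints_iff hg.continuous fun y hy => hy.1).1 hq
    have hy : y ∈ minimizers g q.1 q.2 := by
      rw [hx]; exact (mem_minimizers_charPoint_iff hg.continuous hq0.le).2 hmin
    by_cases hu : ∃! y, y ∈ minimizers g q.1 q.2
    · exact Or.inr ⟨hq, hu⟩
    · refine Or.inl ((mem_nondiffSet_iff hg).2 ⟨hq0, y, hy, ?_⟩)
      by_contra! hall
      exact hu ⟨y, hy, fun y' hy' =>
        eq_of_gradient_eq hg hq0.le hy hy' hyM.1 (hall y' hy').symm⟩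

/-! ### Termination points over a rising segment -/

open AffineMap
/-- Near a noncritical point `y₀`, all points are joined by segments along which `g` increases to
one common point that is reached from `y₀` by moving in the gradient direction. -/
theorem exists_rising_segments (hg : ContDiff ℝ 2 g) {y₀ : EuclideanSpace ℝ (Fin n)}
    (hy₀ : ∇ g y₀ ≠ 0) {O : Set (EuclideanSpace ℝ (Fin n))} (hO : O ∈ 𝓝 y₀) :
    ∃ z, ∀ᶠ y in 𝓝 y₀, (∀ s ∈ Icc (0 : ℝ) 1, lineMap y z s ∈ O) ∧
      StrictMonoOn (fun s : ℝ => g (lineMap y z s)) (Icc 0 1) := by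
  have hP : 0 < ‖∇ g y₀‖ := norm_pos_iff.2 hy₀
  set p := ∇ g y₀ with hp
  have hgrad : ∀ᶠ y in 𝓝 y₀, ‖∇ g y - p‖ < ‖p‖ / 4 := by
    have hc : Continuous fun y => ‖∇ g y - p‖ :=
      ((continuous_gradient hg).sub continuous_const).norm
    exact hc.continuousAt.eventually (gt_mem_nhds (by simpa [hp] using hP))
  obtain ⟨ρ, hρ, hsub⟩ := Metric.mem_nhds_iff.1 (inter_mem hO hgrad)
  set c := ρ / (2 * ‖p‖) with hc
  have hc0 : 0 < c := by positivity
  have hcp : c * ‖p‖ = ρ / 2 := by rw [hc]; field_simp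
  have hz : y₀ + c • p ∈ ball y₀ ρ := by
    rw [mem_ball_iff_norm, add_sub_cancel_left, norm_smul, Real.norm_of_nonneg hc0.le, hcp]
    linarith
  refine ⟨y₀ + c • p, ?_⟩
  filter_upwards [ball_mem_nhds y₀ (show 0 < ρ / 8 by positivity)] with y hy
  have hyρ : y ∈ ball y₀ ρ := ball_subset_ball (by linarith) hy
  have hline : ∀ s ∈ Icc (0 : ℝ) 1, lineMap y (y₀ + c • p) s ∈ ball y₀ ρ := fun s hs =>
    (convex_ball y₀ ρ).lineMap_mem hyρ hz hs
  refine ⟨fun s hs => (hsub (hline s hs)).1, ?_⟩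
  have hder : ∀ s : ℝ, HasDerivAt (fun s : ℝ => g (lineMap y (y₀ + c • p) s))
      (inner ℝ (∇ g (lineMap y (y₀ + c • p) s)) (y₀ + c • p - y)) s := fun s =>
    (hasFDerivAt_innerSL_gradient hg _).comp_hasDerivAt s hasDerivAt_lineMap
  refine strictMonoOn_of_deriv_pos (convex_Icc 0 1)
    (fun s _ => (hder s).continuousAt.continuousWithinAt) fun s hs => ?_
  rw [(hder s).deriv]
  have h1 : ‖∇ g (lineMap y (y₀ + c • p) s) - p‖ < ‖p‖ / 4 :=
    (hsub (hline s (interior_subset hs))).2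
  set q := ∇ g (lineMap y (y₀ + c • p) s)
  have h2 : ‖y₀ - y‖ < ρ / 8 := mem_ball_iff_norm'.1 hy
  have hd : ‖y₀ + c • p - y‖ ≤ ρ / 2 + ρ / 8 := by
    have : y₀ + c • p - y = c • p + (y₀ - y) := by abel
    rw [this]
    refine (norm_add_le _ _).trans (add_le_add ?_ h2.le)
    rw [norm_smul, Real.norm_of_nonneg hc0.le, hcp]
  have hsplit : inner ℝ q (y₀ + c • p - y) =
      c * ‖p‖ * ‖p‖ + inner ℝ p (y₀ - y) + inner ℝ (q - p) (y₀ + c • p - y) := by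
    rw [inner_sub_left q p, add_sub_right_comm, inner_add_right p, real_inner_smul_right,
      real_inner_self_eq_norm_sq]
    ring
  have h3 := (abs_le.1 (abs_real_inner_le_norm p (y₀ - y))).1
  have h4 := (abs_le.1 (abs_real_inner_le_norm (q - p) (y₀ + c • p - y))).1
  have h5 : ‖p‖ * ‖y₀ - y‖ ≤ ‖p‖ * (ρ / 8) := by gcongr
  have h6 : ‖q - p‖ * ‖y₀ + c • p - y‖ ≤ ‖p‖ / 4 * (ρ / 2 + ρ / 8) := by gcongr
  rw [hsplit, hcp]
  nlinarith [mul_pos hP hρ]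

/-- The termination points of a single characteristic form a vertical segment or ray. -/
theorem isPathConnected_terminationPoints_singleton (hg : ContDiff ℝ 2 g)
    {y : EuclideanSpace ℝ (Fin n)} (hy : y ∈ terminatingSet g) :
    IsPathConnected (terminationPoints g {y}) := by
  have hS : ∀ z ∈ ({y} : Set (EuclideanSpace ℝ (Fin n))), ∇ g z ≠ 0 := by
    rintro z rfl; exact hy.1
  let R : Set ℝ := {t | 0 < t ∧ firstTime g y ≤ ENNReal.ofReal t ∧ CharMin g y t}
  have hR : terminationPoints g {y} = (fun t => (charPoint g y t, t)) '' R := by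
    ext ⟨x, t⟩
    rw [mem_terminationPoints_iff hg.continuous hS]
    constructor
    · rintro ⟨ht, _, rfl, hx, h1, h2⟩
      exact ⟨t, ⟨ht, h1, h2⟩, Prod.ext hx.symm rfl⟩
    · rintro ⟨t', ⟨ht, h1, h2⟩, heq⟩
      obtain ⟨rfl, rfl⟩ := Prod.mk.inj heq
      exact ⟨ht, y, rfl, rfl, h1, h2⟩
  have hord : R.OrdConnected := ⟨fun a ha b hb t ht =>
    ⟨ha.1.trans_le ht.1, ha.2.1.trans (ENNReal.ofReal_le_ofReal ht.1), hb.2.2.anti ht.2⟩⟩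
  have h0 : 0 < (firstTime g y).toReal := ENNReal.toReal_pos (firstTime_pos hg hy.1).ne' hy.2.ne
  have hne : R.Nonempty := by
    have heq := ENNReal.ofReal_toReal hy.2.ne
    refine ⟨(firstTime g y).toReal, h0, heq.ge, ?_⟩
    refine charMin_of_le_secondTime hg.continuous hy.1 h0 ?_
    rw [heq]
    exact firstTime_le_secondTime hg.continuous y
  rw [hR]
  refine (hord.convex.isPathConnected hne).image' ?_
  unfold charPoint
  fun_prop

/-- Along a segment on which `g` increases, the two termination times bound a filled graph: they
jump down from `secondTime` to `firstTime` at countably many levels and are continuous in between.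
At the lower end only the first termination time is used, so that this point may have an infinite
second one. -/
theorem isFilledGraph_terminationTimes (hg : ContDiff ℝ 2 g) {γ : ℝ → EuclideanSpace ℝ (Fin n)}
    (hγ : Continuous γ) (hM : ∀ s ∈ Icc (0 : ℝ) 1, γ s ∈ terminatingSet g)
    (hE : ∀ s ∈ Ioc (0 : ℝ) 1, γ s ∈ strictSet g)
    (hmono : StrictMonoOn (fun s => g (γ s)) (Icc 0 1)) :
    IsFilledGraph (fun s => (firstTime g (γ s)).toReal)
      (fun s => if s = 0 then (firstTime g (γ 0)).toReal else (secondTime g (γ s)).toReal) := by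
  have hgc := hg.continuous
  set α : ℝ → ℝ := fun s => (firstTime g (γ s)).toReal with hα
  set β : ℝ → ℝ := fun s => if s = 0 then (firstTime g (γ 0)).toReal
    else (secondTime g (γ s)).toReal with hβ
  have hβ0 : β 0 = α 0 := if_pos rfl
  have hβ1 : ∀ s, s ≠ 0 → β s = (secondTime g (γ s)).toReal := fun s hs => if_neg hs
  have hfin : ∀ s ∈ Icc (0 : ℝ) 1, s ≠ 0 → secondTime g (γ s) ≠ ⊤ := fun s hs h0 =>
    (secondTime_lt_top hgc (hE s ⟨lt_of_le_of_ne hs.1 h0.symm, hs.2⟩)).ne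
  have hα0 : ∀ s ∈ Icc (0 : ℝ) 1, 0 < α s := fun s hs =>
    ENNReal.toReal_pos (firstTime_pos hg (hM s hs).1).ne' (hM s hs).2.ne
  have hle : ∀ s ∈ Icc (0 : ℝ) 1, α s ≤ β s := by
    intro s hs
    rcases eq_or_ne s 0 with rfl | h0
    · exact hβ0.ge
    · rw [hβ1 s h0]
      exact ENNReal.toReal_mono (hfin s hs h0) (firstTime_le_secondTime hgc _)
  have hstrict : ∀ s ∈ Icc (0 : ℝ) 1, ∀ t, t < α s → 0 < t → StrictCharMin g (γ s) t :=
    fun s hs t ht ht0 => strictCharMin_of_lt_firstTime hgc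
      ((ENNReal.ofReal_lt_iff_lt_toReal ht0.le (hM s hs).2.ne).2 ht)
  have hnot : ∀ s ∈ Icc (0 : ℝ) 1, ∀ t, α s < t → ¬ StrictCharMin g (γ s) t :=
    fun s hs t ht => not_strictCharMin_of_firstTime_lt hgc ((hα0 s hs).trans ht)
      ((ENNReal.lt_ofReal_iff_toReal_lt (hM s hs).2.ne).2 ht)
  have hle_α : ∀ s ∈ Icc (0 : ℝ) 1, ∀ t, 0 < t → StrictCharMin g (γ s) t → t ≤ α s :=
    fun s hs t ht h => (ENNReal.ofReal_le_iff_le_toReal (hM s hs).2.ne).1 (h.le_firstTime hgc ht)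
  have hβ_le : ∀ s ∈ Icc (0 : ℝ) 1, ∀ t, 0 < t → ¬ CharMin g (γ s) t → β s ≤ t := by
    intro s hs t ht h
    have h1 := secondTime_le_of_not_charMin hgc ht h
    rcases eq_or_ne s 0 with rfl | h0
    · rw [hβ0]
      exact ENNReal.toReal_le_of_le_ofReal ht.le ((firstTime_le_secondTime hgc _).trans h1)
    · rw [hβ1 s h0]
      exact ENNReal.toReal_le_of_le_ofReal ht.le h1
  have hlow : ∀ s ∈ Icc (0 : ℝ) 1, ∀ t < α s, ∀ᶠ r in 𝓝 s, r ∈ Icc (0 : ℝ) 1 → t < α r := by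
    intro s hs t ht
    obtain ⟨u, hu1, hu2⟩ := exists_between (max_lt ht (hα0 s hs))
    obtain ⟨u', hu1', hu2'⟩ := exists_between hu2
    obtain ⟨htu, hu0⟩ := max_lt_iff.1 hu1
    have hS := hstrict s hs u' hu2' (hu0.trans hu1')
    filter_upwards [hγ.continuousAt.eventually
      (hS.charMin.eventually_strictCharMin hg (hM s hs).1 hu0 hu1')] with r hr hr01
    exact htu.trans_le (hle_α r hr01 u hu0 (hr (Or.inr hS)))
  refine ⟨hle, ?_, fun s hs t ht => ?_, fun s hs t ht => ?_, fun s hs t ht => ?_,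
    fun s hs t ht => ?_⟩
  · refine MapsTo.countable_of_injOn (f := fun s => g (γ s)) (fun s hs => ?_)
      (hmono.injOn.mono fun s hs => hs.1) (countable_localMin_values g)
    obtain ⟨hs, hlt⟩ := hs
    have h0 : s ≠ 0 := by rintro rfl; exact hlt.ne' hβ0
    rw [hβ1 s h0] at hlt
    exact exists_isLocalMin_of_firstTime_lt_secondTime hgc (hM s hs).1
      ((ENNReal.toReal_lt_toReal (hM s hs).2.ne (hfin s hs h0)).1 hlt)
  · filter_upwards [hlow s hs t ht] with r hr hr01 _ using hr hr01
  · obtain ⟨u, hu1, hu2⟩ := exists_between (show α s < t from ht)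
    obtain ⟨u', hu1', hu2'⟩ := exists_between hu1
    have hu0' : 0 < u' := (hα0 s hs).trans hu1'
    filter_upwards [hγ.continuousAt.eventually
      (eventually_not_charMin_of_not_strictCharMin hg (hM s hs).1 hu0' hu2'
        (hnot s hs u' hu1'))] with r hr hr01 hsr
    exact (hβ_le r hr01 u (hu0'.trans hu2') (hr (hmono hs hr01 hsr))).trans_lt hu2
  · rcases eq_or_ne s 0 with rfl | h0
    · exact Eventually.of_forall fun r hr hr0 => absurd hr0 hr.1.not_gt
    · obtain ⟨u, hu1, hu2⟩ := exists_between (max_lt ht ((hα0 s hs).trans_le (hle s hs)))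
      obtain ⟨u', hu1', hu2'⟩ := exists_between hu2
      obtain ⟨htu, hu0⟩ := max_lt_iff.1 hu1
      rw [hβ1 s h0] at hu2'
      have hS : CharMin g (γ s) u' := charMin_of_lt_secondTime hgc (hu0.trans hu1')
        ((ENNReal.ofReal_lt_iff_lt_toReal (hu0.trans hu1').le (hfin s hs h0)).2 hu2')
      filter_upwards [hγ.continuousAt.eventually
        (hS.eventually_strictCharMin hg (hM s hs).1 hu0 hu1')] with r hr hr01 hrs
      exact htu.trans_le (hle_α r hr01 u hu0 (hr (Or.inl (hmono hr01 hs hrs))))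
  · rcases eq_or_ne s 0 with rfl | h0
    · exact Eventually.of_forall fun r hr hr0 => absurd hr0 hr.1.not_gt
    · obtain ⟨u, hu1, hu2⟩ := exists_between (show β s < t from ht)
      have hu0 : 0 < u := ((hα0 s hs).trans_le (hle s hs)).trans hu1
      have hN : ¬ CharMin g (γ s) u := fun h => hu1.not_ge <| by
        rw [hβ1 s h0]
        exact (ENNReal.ofReal_le_iff_le_toReal (hfin s hs h0)).1 (h.le_secondTime hgc)
      filter_upwards [hγ.continuousAt.eventually (eventually_not_charMin hg (hM s hs).1 hN)]
        with r hr hr01 _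
      exact (hβ_le r hr01 u hu0 hr).trans_lt hu2

variable {C : Set (EuclideanSpace ℝ (Fin n))}

theorem joinedIn_of_rising_segment (hg : ContDiff ℝ 2 g) (hC : C ⊆ strictSet g)
    {y z : EuclideanSpace ℝ (Fin n)} (hy : y ∈ extendedComponent g C)
    (hseg : ∀ s ∈ Ioc (0 : ℝ) 1, lineMap y z s ∈ C)
    (hmono : StrictMonoOn (fun s : ℝ => g (lineMap y z s)) (Icc 0 1))
    {p q : EuclideanSpace ℝ (Fin n) × ℝ} (hp : p ∈ terminationPoints g {y})
    (hq : q ∈ terminationPoints g {z}) :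
    JoinedIn (terminationPoints g (extendedComponent g C)) p q := by
  have hgc := hg.continuous
  set γ : ℝ → EuclideanSpace ℝ (Fin n) := fun s => lineMap y z s with hγdef
  have hγ : Continuous γ := lineMap_continuous
  have hγ0 : γ 0 = y := lineMap_apply_zero y z
  have hγ1 : γ 1 = z := lineMap_apply_one y z
  have hsub := extendedComponent_subset_terminatingSet hgc hC
  have hF : ∀ s ∈ Icc (0 : ℝ) 1, γ s ∈ extendedComponent g C := by
    intro s hs
    rcases hs.1.eq_or_lt with rfl | h0
    · rwa [hγ0]
    · exact Or.inl (hseg s ⟨h0, hs.2⟩)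
  have hM : ∀ s ∈ Icc (0 : ℝ) 1, γ s ∈ terminatingSet g := fun s hs => hsub (hF s hs)
  have hG := isFilledGraph_terminationTimes hg hγ hM (fun s hs => hC (hseg s hs)) hmono
  set α : ℝ → ℝ := fun s => (firstTime g (γ s)).toReal with hα
  set β : ℝ → ℝ := fun s => if s = 0 then (firstTime g (γ 0)).toReal
    else (secondTime g (γ s)).toReal with hβ
  have hβle : ∀ s ∈ Icc (0 : ℝ) 1, ∀ t ≤ β s, ENNReal.ofReal t ≤ secondTime g (γ s) := by
    intro s hs t ht
    rcases eq_or_ne s 0 with rfl | h0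
    · refine le_trans ?_ (firstTime_le_secondTime hgc _)
      exact (ENNReal.ofReal_le_iff_le_toReal (hM 0 hs).2.ne).2 (ht.trans_eq (if_pos rfl))
    · have hfin := secondTime_lt_top hgc (hC (hseg s ⟨lt_of_le_of_ne hs.1 h0.symm, hs.2⟩))
      exact (ENNReal.ofReal_le_iff_le_toReal hfin.ne).2 (ht.trans_eq (if_neg h0))
  let Ψ : ℝ × ℝ → EuclideanSpace ℝ (Fin n) × ℝ := fun p => (charPoint g (γ p.1) p.2, p.2)
  have hΨc : ContinuousOn Ψ (filledGraph α β) := by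
    intro p hp
    have h1 : ContinuousAt (fun p : ℝ × ℝ => ∇ g (γ p.1)) p :=
      ((continuous_gradient hg).comp (hγ.comp continuous_fst)).continuousAt
    have h2 : ContinuousAt (fun p : ℝ × ℝ => γ p.1) p := (hγ.comp continuous_fst).continuousAt
    have h3 : ContinuousAt (fun p : ℝ × ℝ => charPoint g (γ p.1) p.2) p :=
      h2.add (continuousAt_snd.smul
        ((h1.norm.inv₀ (norm_ne_zero_iff.2 (hM p.1 hp.1).1)).smul h1))
    exact (h3.prodMk continuousAt_snd).continuousWithinAt
  have hΨ : ∀ s ∈ Icc (0 : ℝ) 1, ∀ t, α s ≤ t → t ≤ β s →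
      ∀ S : Set (EuclideanSpace ℝ (Fin n)), γ s ∈ S → Ψ (s, t) ∈ terminationPoints g S := by
    intro s hs t h1 h2 S hS
    have h0 : 0 < α s :=
      ENNReal.toReal_pos (firstTime_pos hg (hM s hs).1).ne' (hM s hs).2.ne
    exact ⟨h0.trans_le h1, γ s, hS, rfl,
      ENNReal.le_ofReal_iff_toReal_le (hM s hs).2.ne (h0.le.trans h1) |>.2 h1, hβle s hs t h2⟩
  have h0 : (0 : ℝ) ∈ Icc (0 : ℝ) 1 := by simp
  have h1 : (1 : ℝ) ∈ Icc (0 : ℝ) 1 := by simp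
  have hcurve : JoinedIn (terminationPoints g (extendedComponent g C)) (Ψ (0, α 0)) (Ψ (1, α 1)) :=
    ((hG.isPathConnected.image' hΨc).joinedIn _ (mem_image_of_mem Ψ ⟨h0, le_rfl, hG.le 0 h0⟩) _
      (mem_image_of_mem Ψ ⟨h1, le_rfl, hG.le 1 h1⟩)).mono
      (image_subset_iff.2 fun p hp => hΨ p.1 hp.1 p.2 hp.2.1 hp.2.2 _ (hF p.1 hp.1))
  have hfib : ∀ s ∈ Icc (0 : ℝ) 1, ∀ p ∈ terminationPoints g {γ s},
      JoinedIn (terminationPoints g (extendedComponent g C)) p (Ψ (s, α s)) := fun s hs p hp =>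
    ((isPathConnected_terminationPoints_singleton hg (hM s hs)).joinedIn p hp _
      (hΨ s hs _ le_rfl (hG.le s hs) _ rfl)).mono
      (terminationPoints_mono (singleton_subset_iff.2 (hF s hs)))
  exact ((hfib 0 h0 p (by rwa [hγ0])).trans hcurve).trans (hfib 1 h1 q (by rwa [hγ1])).symm

/-! ### The components -/

theorem eventually_joinedIn (hg : ContDiff ℝ 2 g) (hC : C ⊆ strictSet g) (hCo : IsOpen C)
    {y₀ : EuclideanSpace ℝ (Fin n)} (hy₀ : y₀ ∈ C) :
    ∀ᶠ y in 𝓝 y₀, ∀ p ∈ terminationPoints g {y₀}, ∀ q ∈ terminationPoints g {y},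
      JoinedIn (terminationPoints g (extendedComponent g C)) p q := by
  obtain ⟨z, hz⟩ := exists_rising_segments hg (hC hy₀).1 (hCo.mem_nhds hy₀)
  have hzC : z ∈ C := by simpa using hz.self_of_nhds.1 1 (by simp)
  obtain ⟨r, hr⟩ := (isPathConnected_terminationPoints_singleton hg
    (strictSet_subset_terminatingSet hg.continuous (hC hzC))).nonempty
  have key : ∀ᶠ y in 𝓝 y₀, ∀ p ∈ terminationPoints g {y},
      JoinedIn (terminationPoints g (extendedComponent g C)) p r := by
    filter_upwards [hz, hCo.mem_nhds hy₀] with y hy hyC p hp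
    exact joinedIn_of_rising_segment hg hC (Or.inl hyC) (fun s hs => hy.1 s ⟨hs.1.le, hs.2⟩) hy.2
      hp hr
  filter_upwards [key] with y hy p hp q hq
  exact (key.self_of_nhds p hp).trans (hy q hq).symm

theorem joinedIn_of_mem_component (hg : ContDiff ℝ 2 g) (hC : C ⊆ strictSet g) (hCo : IsOpen C)
    (hCc : IsPreconnected C) {y z : EuclideanSpace ℝ (Fin n)} (hy : y ∈ C) (hz : z ∈ C)
    {p q : EuclideanSpace ℝ (Fin n) × ℝ} (hp : p ∈ terminationPoints g {y})
    (hq : q ∈ terminationPoints g {z}) :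
    JoinedIn (terminationPoints g (extendedComponent g C)) p q := by
  refine hCc.induction₂ (fun y z => ∀ p ∈ terminationPoints g {y}, ∀ q ∈ terminationPoints g {z},
      JoinedIn (terminationPoints g (extendedComponent g C)) p q)
    (fun y hy => eventually_nhdsWithin_of_eventually_nhds (eventually_joinedIn hg hC hCo hy))
    ?_ (fun _ _ _ _ h q hq p hp => (h p hp q hq).symm) hy hz p hp q hq
  intro y₁ y₂ y₃ _ h2 _ h12 h23 p hp q hq
  obtain ⟨r, hr⟩ := (isPathConnected_terminationPoints_singleton hg
    (strictSet_subset_terminatingSet hg.continuous (hC h2))).nonempty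
  exact (h12 p hp r hr).trans (h23 r hr q hq)

theorem isPathConnected_terminationPoints_extendedComponent (hg : ContDiff ℝ 2 g)
    (hC : C ⊆ strictSet g) (hCo : IsOpen C) (hCc : IsPreconnected C) (hne : C.Nonempty) :
    IsPathConnected (terminationPoints g (extendedComponent g C)) := by
  obtain ⟨c, hc⟩ := hne
  obtain ⟨r, hr⟩ := (isPathConnected_terminationPoints_singleton hg
    (strictSet_subset_terminatingSet hg.continuous (hC hc))).nonempty
  refine ⟨r, terminationPoints_mono (singleton_subset_iff.2 (Or.inl hc)) hr, fun {p} hp => ?_⟩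
  obtain ⟨hp0, y, hy, hp'⟩ := hp
  have hpy : p ∈ terminationPoints g {y} := ⟨hp0, y, rfl, hp'⟩
  rcases hy with hyC | ⟨hyM, U, hU, hUC⟩
  · exact joinedIn_of_mem_component hg hC hCo hCc hc hyC hr hpy
  · obtain ⟨z, hz⟩ := exists_rising_segments hg hyM.1.1 hU
    obtain ⟨hseg, hmono⟩ := hz.self_of_nhds
    have hsegC : ∀ s ∈ Ioc (0 : ℝ) 1, lineMap y z s ∈ C := by
      intro s hs
      refine hUC ⟨hseg s ⟨hs.1.le, hs.2⟩, ?_⟩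
      have := hmono (left_mem_Icc.2 zero_le_one) ⟨hs.1.le, hs.2⟩ hs.1
      simpa using this
    have hzC : z ∈ C := by simpa using hsegC 1 (by simp)
    obtain ⟨r', hr'⟩ := (isPathConnected_terminationPoints_singleton hg
      (strictSet_subset_terminatingSet hg.continuous (hC hzC))).nonempty
    exact (joinedIn_of_mem_component hg hC hCo hCc hc hzC hr hr').trans
      (joinedIn_of_rising_segment hg hC (Or.inr ⟨hyM, U, hU, hUC⟩) hsegC hmono hpy hr').symm

/-- Every point of `M` belongs to one of the sets `F_i`. For a point outside `E`, the nearby points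
on higher levels lie in `E` and are joined in `E` along rising segments. -/
theorem exists_mem_extendedComponent (hg : ContDiff ℝ 2 g) {y : EuclideanSpace ℝ (Fin n)}
    (hy : y ∈ terminatingSet g) :
    ∃ C ∈ pathComponents (strictSet g), y ∈ extendedComponent g C := by
  by_cases hyE : y ∈ strictSet g
  · exact ⟨_, ⟨y, hyE, rfl⟩, Or.inl (mem_pathComponentIn_self hyE)⟩
  obtain ⟨w, hw, hle⟩ := exists_halfSpace_le hg.continuous hy
  have hO : {z | ∇ g z ≠ 0 ∧ w ∈ halfSpace g z} ∈ 𝓝 y := by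
    have hc := continuous_gradient hg
    have hinner : Continuous fun z => inner ℝ (w - z) (∇ g z) :=
      (continuous_const.sub continuous_id).inner hc
    exact inter_mem (hc.continuousAt.eventually_ne hy.1)
      (hinner.continuousAt.eventually (lt_mem_nhds hw))
  obtain ⟨z, hz⟩ := exists_rising_segments hg hy.1 hO
  have hmem : ∀ x, x ∈ {z | ∇ g z ≠ 0 ∧ w ∈ halfSpace g z} → g y < g x → x ∈ strictSet g :=
    fun x hx hlt => ⟨hx.1, w, hx.2, hle.trans_lt hlt⟩
  have hzE : z ∈ strictSet g := by
    obtain ⟨h1, h2⟩ := hz.self_of_nhds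
    refine hmem z (by simpa using h1 1 (by simp)) ?_
    simpa using h2 (left_mem_Icc.2 zero_le_one) (right_mem_Icc.2 zero_le_one) one_pos
  refine ⟨_, ⟨z, hzE, rfl⟩, Or.inr ⟨⟨hy, hyE⟩, _, hz, ?_⟩⟩
  rintro x ⟨⟨hseg, hmono⟩, hlt⟩
  have hsub : segment ℝ x z ⊆ strictSet g := by
    rw [segment_eq_image_lineMap]
    rintro _ ⟨s, hs, rfl⟩
    refine hmem _ (hseg s hs) (lt_of_lt_of_le hlt ?_)
    simpa using hmono.monotoneOn (left_mem_Icc.2 zero_le_one) hs hs.1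
  exact (JoinedIn.of_segment_subset hsub).symm

theorem countable_pathComponents_of_isOpen {X : Type*} [TopologicalSpace X]
    [TopologicalSpace.SeparableSpace X] [LocallyPathConnectedSpace X] {A : Set X} (hA : IsOpen A) :
    (pathComponents A).Countable := by
  obtain ⟨D, hDc, hD⟩ := TopologicalSpace.exists_countable_dense X
  refine (hDc.image (pathComponentIn A)).mono ?_
  rintro _ ⟨x, hx, rfl⟩
  obtain ⟨d, hd, hdD⟩ := hD.inter_open_nonempty _ (hA.pathComponentIn x)
    ⟨x, mem_pathComponentIn_self hx⟩
  exact ⟨d, hdD, pathComponentIn_congr hd⟩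

/-- A union of countably many path connected sets has countably many path components. -/
theorem countable_pathComponents_biUnion {X ι : Type*} [TopologicalSpace X] {I : Set ι}
    (hI : I.Countable) {B : ι → Set X} (hB : ∀ i ∈ I, IsPathConnected (B i)) :
    (pathComponents (⋃ i ∈ I, B i)).Countable := by
  have hchoice : ∀ i, ∃ x : Set X, ∀ b ∈ B i, i ∈ I → pathComponentIn (⋃ i ∈ I, B i) b = x := by
    intro i
    by_cases hi : i ∈ I
    · obtain ⟨b, hb⟩ := (hB i hi).nonempty
      refine ⟨pathComponentIn (⋃ i ∈ I, B i) b, fun b' hb' _ => pathComponentIn_congr ?_⟩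
      exact ((hB i hi).joinedIn b hb b' hb').mono (subset_biUnion_of_mem (u := B) hi)
    · exact ⟨∅, fun _ _ h => absurd h hi⟩
  choose f hf using hchoice
  refine (hI.image f).mono ?_
  rintro _ ⟨x, hx, rfl⟩
  obtain ⟨i, hi, hxi⟩ := mem_iUnion₂.1 hx
  exact ⟨i, hi, (hf i x hxi hi).symm⟩

theorem eq_sUnion_pathComponents {X : Type*} [TopologicalSpace X] (A : Set X) :
    A = ⋃₀ pathComponents A := by
  refine Subset.antisymm (fun x hx => ⟨_, ⟨x, hx, rfl⟩, mem_pathComponentIn_self hx⟩) ?_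
  rintro x ⟨_, ⟨y, -, rfl⟩, hxy⟩
  exact pathComponentIn_subset hxy

end Eikonal

theorem theorem4p1 (n : ℕ) (g : EuclideanSpace ℝ (Fin n) → ℝ) (hg : ContDiff ℝ 2 g) :
    -- there are at most countably many `E_i`, hence at most countably many `F_i`
    (Eikonal.pathComponents (Eikonal.strictSet g)).Countable ∧
    -- `Σ ∪ T₁ = ⋃ T(F_i)`
    Eikonal.nondiffSet g ∪ Eikonal.uniqueTerminationSet g =
      ⋃ C ∈ Eikonal.pathComponents (Eikonal.strictSet g),
        Eikonal.terminationPoints g (Eikonal.extendedComponent g C) ∧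
    -- each `T(F_i)` is path connected
    (∀ C ∈ Eikonal.pathComponents (Eikonal.strictSet g),
      IsPathConnected (Eikonal.terminationPoints g (Eikonal.extendedComponent g C))) ∧
    -- `Σ ∪ T₁` is the union of its path components `S_j`, which are at most countably many
    (Eikonal.pathComponents (Eikonal.nondiffSet g ∪ Eikonal.uniqueTerminationSet g)).Countable ∧
    Eikonal.nondiffSet g ∪ Eikonal.uniqueTerminationSet g =
      ⋃₀ Eikonal.pathComponents (Eikonal.nondiffSet g ∪ Eikonal.uniqueTerminationSet g) := by
  have hopen := Eikonal.isOpen_strictSet hg.continuous (Eikonal.continuous_gradient hg)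
  have hcount := Eikonal.countable_pathComponents_of_isOpen hopen
  have hsub : ∀ C ∈ Eikonal.pathComponents (Eikonal.strictSet g), C ⊆ Eikonal.strictSet g := by
    rintro _ ⟨y, -, rfl⟩
    exact pathComponentIn_subset
  have hunion : Eikonal.nondiffSet g ∪ Eikonal.uniqueTerminationSet g =
      ⋃ C ∈ Eikonal.pathComponents (Eikonal.strictSet g),
        Eikonal.terminationPoints g (Eikonal.extendedComponent g C) := by
    rw [Eikonal.nondiffSet_union_uniqueTerminationSet hg]
    refine Set.Subset.antisymm ?_ (Set.iUnion₂_subset fun C hC =>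
      Eikonal.terminationPoints_mono
        (Eikonal.extendedComponent_subset_terminatingSet hg.continuous (hsub C hC)))
    rintro p ⟨hp, y, hy, hp'⟩
    obtain ⟨C, hC, hyC⟩ := Eikonal.exists_mem_extendedComponent hg hy
    exact Set.mem_iUnion₂.2 ⟨C, hC, hp, y, hyC, hp'⟩
  have hpath : ∀ C ∈ Eikonal.pathComponents (Eikonal.strictSet g),
      IsPathConnected (Eikonal.terminationPoints g (Eikonal.extendedComponent g C)) := by
    rintro _ ⟨y, hy, rfl⟩
    have hc := isPathConnected_pathComponentIn hy
    exact Eikonal.isPathConnected_terminationPoints_extendedComponent hg pathComponentIn_subset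
      (hopen.pathComponentIn y) hc.isConnected.isPreconnected hc.nonempty
  refine ⟨hcount, hunion, hpath, ?_, Eikonal.eq_sUnion_pathComponents _⟩
  rw [hunion]
  exact Eikonal.countable_pathComponents_biUnion hcount hpath
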